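/- Let $n\ge 1$, write points of $\mathbb R^{2n}$ as $(x,y)$ with $x,y\in\mathbb R^n$, and let $\mathbb H$ be the quaternions with units $i,j,k$. Let $\mathcal F_Q$ be the two-sided quaternion Fourier transform $$\mathcal F_Q(g)(u,v)=\int_{\mathbb R^{2n}}e^{-2\pi i\,u\cdot x}\,g(x,y)\,e^{-2\pi j\,v\cdot y}\,dx\,dy,\qquad g\in L^1\cap L^2(\mathbb R^{2n},\mathbb H),$$ extended by continuity to $L^2(\mathbb R^{2n},\mathbb H)$. For $a\in\mathbb R^*=\mathbb R\setminus\{0\}$ and $s\in\mathbb R^{2n-1}$ let $$A_a=\begin{pmatrix}a&0\\0&\operatorname{sg}(a)|a|^{\frac1{2n}}I_{2n-1}\end{pmatrix},\qquad S_s=\begin{pmatrix}1&s^T\\0&I_{2n-1}\end{pmatrix},$$ and for $t\in\mathbb R^{2n}$ put $\psi_{a,s,t}(x)=|a|^{\frac1{4n}-1}\psi\big(A_a^{-1}S_s^{-1}(x-t)\big)$ and $$\mathcal{SH}^Q_\psi(f)(a,s,t)=\int_{\mathbb R^{2n}}f(x)\,\overline{\psi_{a,s,t}(x)}\,dx .$$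 Let $d\mu(a,s,t)=|a|^{-(2n+1)}\,da\,ds\,dt$ on $\mathbb R^*\times\mathbb R^{2n-1}\times\mathbb R^{2n}$. A function $\psi\in L^2(\mathbb R^{2n},\mathbb H)$ is called admissible if $$C_\psi=\int_{\mathbb R^{2n}}\frac{|\mathcal F_Q(\psi^*)(\lambda)|^2}{|\lambda_1|^{2n}}\,d\lambda<\infty,\qquad \psi^*(x)=\overline{\psi(-x)} .$$ For a function $P\ge 0$ let $E(P)=-\int \ln(P)\,P\,d\mu$ (with $0\ln 0=0$). Let $\psi\in L^2(\mathbb R^{2n},\mathbb H)$ be a nonzero admissible function such that, for almost every $(u,v)\in\mathbb R^{2n}$ and all $t\in\mathbb R^n$, $$\mathcal F_Q(\psi)(u,v)\,e^{-2\pi j\,v\cdot t}=e^{-2\pi j\,v\cdot t}\,\mathcal F_Q(\psi)(u,v),\qquad \mathcal F_Q(j\psi)(u,v)\,e^{-2\pi j\,v\cdot t}=j\,e^{-2\pi j\,v\cdot t}\,\mathcal F_Q(\psi)(u,v).$$ Then for every $f\in L^2(\mathbb R^{2n},\mathbb H)$ with $f\ne0$ the integral defining $E(|\mathcal{SH}^Q_\psi(f)|^2)$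 exists in $(-\infty,+\infty]$, and $$E\big(|\mathcal{SH}^Q_\psi(f)|^2\big)\ \ge\ C_\psi\,\|f\|_2^2\,\ln\!\Big(\frac{1}{\|f\|_2^2\,\|\psi\|_2^2}\Big).$$ -/

import Mathlib

open scoped Quaternion ENNReal Matrix Topology
open MeasureTheory Filter

noncomputable section

namespace QuaternionShearlet

/-- The space `ℝ^m` with its Euclidean structure and Lebesgue measure. -/
abbrev E (m : ℕ) : Type := EuclideanSpace ℝ (Fin m)

/-- The imaginary unit `i` of the quaternions. -/
def qi : ℍ[ℝ] := ⟨0, 1, 0, 0⟩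

/-- The imaginary unit `j` of the quaternions. -/
def qj : ℍ[ℝ] := ⟨0, 0, 1, 0⟩

/-- `e^{iθ} = cos θ + i sin θ`. -/
def expI (θ : ℝ) : ℍ[ℝ] := ⟨Real.cos θ, Real.sin θ, 0, 0⟩

/-- `e^{jθ} = cos θ + j sin θ`. -/
def expJ (θ : ℝ) : ℍ[ℝ] := ⟨Real.cos θ, 0, Real.sin θ, 0⟩

/-- The first `n` coordinates of a vector of `ℝ^{2n}`. -/
def fstHalf {n : ℕ} (x : E (2 * n)) : E n :=
  WithLp.toLp 2 fun k : Fin n => x ⟨k.1, by omega⟩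

/-- The last `n` coordinates of a vector of `ℝ^{2n}`. -/
def sndHalf {n : ℕ} (x : E (2 * n)) : E n :=
  WithLp.toLp 2 fun k : Fin n => x ⟨n + k.1, by omega⟩

/-- The two-sided quaternion Fourier integral
`∫ e^{-2πi u·x} g(x,y) e^{-2πj v·y} dx dy` at `w = (u,v)`, for integrable `g`. -/
def qftIntegral {n : ℕ} (g : E (2 * n) → ℍ[ℝ]) (w : E (2 * n)) : ℍ[ℝ] :=
  ∫ z : E (2 * n),
    expI (-(2 * Real.pi * inner ℝ (fstHalf w) (fstHalf z))) * g z *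
      expJ (-(2 * Real.pi * inner ℝ (sndHalf w) (sndHalf z)))

/-- `G ∈ L²` is the value at `g` of the extension by continuity to `L²` of the quaternion Fourier
transform on `L¹ ∩ L²`: whenever functions of `L¹ ∩ L²` converge to `g` in `L²`, their Fourier
integrals converge to `G` in `L²`. -/
def IsQFT {n : ℕ} (g G : E (2 * n) → ℍ[ℝ]) : Prop :=
  MemLp G 2 volume ∧
    ∀ h : ℕ → E (2 * n) → ℍ[ℝ],
      (∀ k, MemLp (h k) 1 volume ∧ MemLp (h k) 2 volume) →
      Tendsto (fun k => eLpNorm (h k - g) 2 volume) atTop (𝓝 0) →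
      Tendsto (fun k => eLpNorm (qftIntegral (h k) - G) 2 volume) atTop (𝓝 0)

open Classical in
/-- The quaternion Fourier transform on `L²(ℝ^{2n}, ℍ)`, as a function determined up to a null set.
By Plancherel's formula the first case always occurs for `g` in `L²`. -/
def qft {n : ℕ} (g : E (2 * n) → ℍ[ℝ]) : E (2 * n) → ℍ[ℝ] :=
  if h : ∃ G, IsQFT g G then h.choose else 0

/-- The dilation matrix `A_a`, diagonal with entries `a, sg(a)|a|^{1/(2n)}, …, sg(a)|a|^{1/(2n)}`. -/
def dilationMatrix (n : ℕ) (a : ℝ) : Matrix (Fin (2 * n)) (Fin (2 * n)) ℝ :=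
  Matrix.diagonal fun k =>
    if k.1 = 0 then a else Real.sign a * |a| ^ (1 / (2 * (n : ℝ)))

/-- The shear matrix `S_s`: the identity, with first row `(1, s₁, …, s_{2n-1})`. -/
def shearMatrix (n : ℕ) (s : E (2 * n - 1)) : Matrix (Fin (2 * n)) (Fin (2 * n)) ℝ :=
  Matrix.of fun k l =>
    if k = l then 1
    else if h : k.1 = 0 ∧ l.1 ≠ 0 then s ⟨l.1 - 1, by omega⟩
    else 0

/-- `ψ_{a,s,t}(x) = |a|^{1/(4n) - 1} ψ(A_a⁻¹ S_s⁻¹ (x - t))`. -/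
def shearletAtom {n : ℕ} (ψ : E (2 * n) → ℍ[ℝ]) (a : ℝ) (s : E (2 * n - 1)) (t x : E (2 * n)) :
    ℍ[ℝ] :=
  |a| ^ (1 / (4 * (n : ℝ)) - 1) •
    ψ (WithLp.toLp 2 (((dilationMatrix n a)⁻¹ * (shearMatrix n s)⁻¹) *ᵥ (x - t).ofLp))

/-- The continuous quaternion shearlet transform
`SH_ψ f (a,s,t) = ∫ f(x) conj(ψ_{a,s,t}(x)) dx`. -/
def shearletTransform {n : ℕ} (ψ f : E (2 * n) → ℍ[ℝ]) (p : ℝ × E (2 * n - 1) × E (2 * n)) :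
    ℍ[ℝ] :=
  ∫ x : E (2 * n), f x * star (shearletAtom ψ p.1 p.2.1 p.2.2 x)

/-- The left Haar measure `da ds dt / |a|^{2n+1}` on `ℝ^* × ℝ^{2n-1} × ℝ^{2n}`
(as a measure on `ℝ × ℝ^{2n-1} × ℝ^{2n}` that does not charge `a = 0`). -/
def haarLeft (n : ℕ) : Measure (ℝ × E (2 * n - 1) × E (2 * n)) :=
  (volume.restrict {p | p.1 ≠ 0}).withDensity fun p => ENNReal.ofReal (1 / |p.1| ^ (2 * n + 1))

/-- The constant `C_ψ = ∫ |F_Q(ψ^*)(λ)|² / |λ₁|^{2n} dλ ∈ [0, ∞]`, `ψ^*(x) = conj(ψ(-x))`. -/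
def admissibilityConst {n : ℕ} [NeZero n] (ψ : E (2 * n) → ℍ[ℝ]) : ℝ≥0∞ :=
  ∫⁻ l : E (2 * n), ENNReal.ofReal (‖qft (fun x => star (ψ (-x))) l‖ ^ 2 / |l 0| ^ (2 * n))

/-- Admissible quaternion shearlets: `ψ ∈ L²(ℝ^{2n}, ℍ)` with `C_ψ < ∞`. -/
def IsAdmissible {n : ℕ} [NeZero n] (ψ : E (2 * n) → ℍ[ℝ]) : Prop :=
  MemLp ψ 2 volume ∧ admissibilityConst ψ < ⊤

/-- The hypothesis of the convolution theorem on `g`: for (almost) all `(u,v)` and all `t ∈ ℝ^n`,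
`F_Q(g)(u,v) e^{-2πj v·t} = e^{-2πj v·t} F_Q(g)(u,v)` and
`F_Q(jg)(u,v) e^{-2πj v·t} = j e^{-2πj v·t} F_Q(g)(u,v)`. -/
def ConvolutionHyp {n : ℕ} (g : E (2 * n) → ℍ[ℝ]) : Prop :=
  ∀ᵐ w : E (2 * n), ∀ t : E n,
    qft g w * expJ (-(2 * Real.pi * inner ℝ (sndHalf w) t)) =
        expJ (-(2 * Real.pi * inner ℝ (sndHalf w) t)) * qft g w ∧
      qft (fun x => qj * g x) w * expJ (-(2 * Real.pi * inner ℝ (sndHalf w) t)) =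
        qj * expJ (-(2 * Real.pi * inner ℝ (sndHalf w) t)) * qft g w

/-- The entropy `E(P) = -∫ ln(P) P dμ` of a function `P ≥ 0`, with `0 ln 0 = 0`, as the integral of
the positive part minus that of the negative part of `-P ln P`, with values in `[-∞, ∞]`.
If the negative part has infinite integral (where the integral is `-∞` or undefined) the value is
`-∞`. Hence a lower bound `c ≤ E(P)` by a real number `c` includes that the integral exists. -/
def entropy {α : Type*} [MeasurableSpace α] (μ : Measure α) (P : α → ℝ) : EReal :=
  ((∫⁻ x, ENNReal.ofReal (-(Real.log (P x) * P x)) ∂μ : ℝ≥0∞) : EReal) -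
    ((∫⁻ x, ENNReal.ofReal (Real.log (P x) * P x) ∂μ : ℝ≥0∞) : EReal)

/-- The norm `‖f‖₂` of `f ∈ L²(ℝ^m, ℍ)`. -/
def l2norm {m : ℕ} (f : E m → ℍ[ℝ]) : ℝ := (eLpNorm f 2 volume).toReal

end QuaternionShearlet

end

/-!
The reason for the inequality is that `P = |SH_ψ f|²` is bounded by `K = ‖f‖² ‖ψ‖²`
(Cauchy–Schwarz, since every atom has the `L²` norm of `ψ`) and has integral `C_ψ ‖f‖²` for the
left Haar measure. Then `-P ln P ≥ P ln (1/K)` pointwise, and integration gives the bound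
(`le_entropy`).

The substance is the orthogonality relation `∫ |SH_ψ f|² dμ = C_ψ ‖f‖²`
(`shearletTransform_integral`), which reduces to complex functions. Write quaternions as `c z₁ + i
c z₂`, where `c : ℂ → ℍ` sends the imaginary unit to `j`. In these coordinates the two-sided
transform `F_Q(g)(u,v)` is a combination of the complex Fourier transforms of the two coordinates
of `g` at `(u,v)` and `(-u,v)` (`coord_qftIntegral`); Plancherel's theorem for the latter gives
the extension to `L²` (`isQFT_qftL2`). The commutation hypothesis says that `F_Q(ψ)` has values in
the span of `1` and `j`, and the second identity, because `F_Q(jψ)(u,v) = j F_Q(ψ)(-u,v)`, that it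
is even in `u`. Hence `ψ` itself has values in the span of `1` and `j`, with complex Fourier
transform even in `u` (`fourierL2_of_convolutionHyp`), and `C_ψ` is the classical constant `∫
|ψ̂(ω)|² / |ω₁|^{2n} dω` (`admissibilityConst_eq`). Right multiplication by such values respects
the two coordinates of `f`, so `|SH_ψ f|²` is the sum of the squares of two complex shearlet
transforms (`norm_sq_shearletTransform`).

For complex functions, `t ↦ SH_φ f(a,s,t)` is the inverse Fourier transform of `f̂(ξ)
conj(|a|^{1-1/(4n)} φ̂(A_aᵀ S_sᵀ ξ))` (`complexTransform_eq_fourierInv`). Plancherel's formula in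
`t` and the substitution `ω = A_aᵀ S_sᵀ ξ` in `(a,s)` (`lintegral_transpose_shearletMatrix`) give
the relation (`lintegral_enorm_complexTransform`). That product is integrable for every `(a,s)`
with `a ≠ 0`, but need not be square integrable; the finiteness of `C_φ` makes it so for almost
every `(a,s)`, before Plancherel's formula is applied.
-/

noncomputable section

namespace QuaternionShearlet

open FourierTransform

/-! ### The complex Fourier transform on `L²` -/

section FourierL2

variable {V : Type*} [NormedAddCommGroup V] [InnerProductSpace ℝ V] [FiniteDimensional ℝ V]
  [MeasurableSpace V] [BorelSpace V]

theorem continuous_fourier_of_integrable {h : V → ℂ} (hh : Integrable h) : Continuous (𝓕 h) :=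
  VectorFourier.fourierIntegral_continuous Real.continuous_fourierChar
    (by exact continuous_inner) hh

/-- On `L¹ ∩ L²` the `L²` Fourier transform is the Fourier integral: both have the same integrals
against test functions. -/
theorem fourier_toLp_ae_eq {h : V → ℂ} (h1 : Integrable h) (h2 : MemLp h 2 volume) :
    (𝓕 (h2.toLp h) : Lp (α := V) ℂ 2 volume) =ᵐ[volume] 𝓕 h := by
  refine ae_eq_of_integral_contDiff_smul_eq ?_
    (continuous_fourier_of_integrable h1).locallyIntegrable ?_
  · exact (Lp.memLp _).locallyIntegrable (by norm_num)
  intro g hg hgc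
  have hgc' : HasCompactSupport (fun x => (g x : ℂ)) :=
    hgc.comp_left (g := fun x : ℝ => (x : ℂ)) rfl
  have hg' : ContDiff ℝ ((⊤ : ℕ∞) : WithTop ℕ∞) (fun x => (g x : ℂ)) :=
    Complex.ofRealCLM.contDiff.comp hg
  set G : SchwartzMap V ℂ := hgc'.toSchwartzMap hg' with hG
  have hGx : ∀ x, G x = (g x : ℂ) := fun x => rfl
  have key := congrArg (fun T => T G) (Lp.fourier_toTemperedDistribution_eq (h2.toLp h))
  simp only [TemperedDistribution.fourier_apply, Lp.toTemperedDistribution_apply] at key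
  have e1 : ∫ x, (𝓕 G) x • (h2.toLp h) x = ∫ x, (𝓕 (G : V → ℂ)) x • h x := by
    refine integral_congr_ae ?_
    filter_upwards [h2.coeFn_toLp] with x hx
    rw [hx]; rfl
  have e2 : ∫ x, (𝓕 (G : V → ℂ)) x • h x = ∫ x, (G x) • 𝓕 h x := by
    have := VectorFourier.integral_fourierIntegral_smul_eq_flip (L := innerₗ V) (μ := volume)
      (ν := volume) Real.continuous_fourierChar (by exact continuous_inner) G.integrable h1
    rw [flip_innerₗ] at this
    exact this
  have e3 : ∀ F : V → ℂ, ∫ x, g x • F x = ∫ x, G x • F x := by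
    intro F
    refine integral_congr_ae (Eventually.of_forall fun x => ?_)
    simp [hGx]
  rw [e3, e3, ← key, e1, e2]

open Classical in
/-- The Fourier transform on `L²(V, ℂ)`, acting on functions rather than on classes; it is `0` off
`L²`. -/
def fourierL2 (g : V → ℂ) : V → ℂ :=
  if hg : MemLp g 2 volume then (𝓕 (hg.toLp g) : Lp (α := V) ℂ 2 volume) else 0

theorem fourierL2_of_memLp {g : V → ℂ} (hg : MemLp g 2 volume) :
    fourierL2 g = (𝓕 (hg.toLp g) : Lp (α := V) ℂ 2 volume) := by
  simp [fourierL2, hg]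

theorem stronglyMeasurable_fourierL2 (g : V → ℂ) : StronglyMeasurable (fourierL2 g) := by
  unfold fourierL2
  split_ifs
  · exact Lp.stronglyMeasurable _
  · exact stronglyMeasurable_zero

theorem memLp_fourierL2 (g : V → ℂ) : MemLp (fourierL2 g) 2 volume := by
  unfold fourierL2
  split_ifs
  · exact Lp.memLp _
  · exact MemLp.zero

theorem fourierL2_ae_eq_fourier {h : V → ℂ} (h1 : Integrable h) (h2 : MemLp h 2 volume) :
    fourierL2 h =ᵐ[volume] 𝓕 h := by
  rw [fourierL2_of_memLp h2]; exact fourier_toLp_ae_eq h1 h2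

theorem fourierL2_sub {g h : V → ℂ} (hg : MemLp g 2 volume) (hh : MemLp h 2 volume) :
    fourierL2 (g - h) =ᵐ[volume] fourierL2 g - fourierL2 h := by
  rw [fourierL2_of_memLp hg, fourierL2_of_memLp hh, fourierL2_of_memLp (hg.sub hh)]
  rw [MemLp.toLp_sub, sub_eq_add_neg, FourierTransform.fourier_add, FourierTransform.fourier_neg,
    ← sub_eq_add_neg]
  exact Lp.coeFn_sub _ _

theorem fourierL2_const_mul (c : ℂ) {g : V → ℂ} (hg : MemLp g 2 volume) :
    fourierL2 (fun x => c * g x) =ᵐ[volume] fun x => c * fourierL2 g x := by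
  have : (fun x => c * g x) = c • g := rfl
  rw [this, fourierL2_of_memLp hg, fourierL2_of_memLp (hg.const_smul c), MemLp.toLp_const_smul,
    FourierTransform.fourier_smul]
  exact Lp.coeFn_smul _ _

/-- Plancherel's formula. -/
theorem eLpNorm_fourierL2 {g : V → ℂ} (hg : MemLp g 2 volume) :
    eLpNorm (fourierL2 g) 2 volume = eLpNorm g 2 volume := by
  rw [fourierL2_of_memLp hg, ← Lp.enorm_def, ← eLpNorm_congr_ae hg.coeFn_toLp, ← Lp.enorm_def,
    ← ofReal_norm, Lp.norm_fourier_eq, ofReal_norm]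

theorem eLpNorm_fourierL2_sub {g h : V → ℂ} (hg : MemLp g 2 volume) (hh : MemLp h 2 volume) :
    eLpNorm (fourierL2 g - fourierL2 h) 2 volume = eLpNorm (g - h) 2 volume := by
  rw [← eLpNorm_congr_ae (fourierL2_sub hg hh), eLpNorm_fourierL2 (hg.sub hh)]

theorem integral_fourierL2_mul_conj {g h : V → ℂ} (hg : MemLp g 2 volume)
    (hh : MemLp h 2 volume) :
    ∫ x, fourierL2 g x * star (fourierL2 h x) = ∫ x, g x * star (h x) := by
  have := Lp.inner_fourier_eq (hh.toLp h) (hg.toLp g)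
  simp only [MeasureTheory.L2.inner_def] at this
  rw [← fourierL2_of_memLp hg, ← fourierL2_of_memLp hh] at this
  simp only [RCLike.inner_apply] at this
  refine this.trans (integral_congr_ae ?_)
  filter_upwards [hg.coeFn_toLp, hh.coeFn_toLp] with x h1 h2
  rw [h1, h2]; rfl

theorem exists_seq_tendsto_eLpNorm {F : Type*} [NormedAddCommGroup F] [NormedSpace ℝ F]
    {g : V → F} (hg : MemLp g 2 volume) :
    ∃ h : ℕ → V → F, (∀ k, MemLp (h k) 1 volume ∧ MemLp (h k) 2 volume) ∧
      Tendsto (fun k => eLpNorm (h k - g) 2 volume) atTop (𝓝 0) := by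
  have H : ∀ k : ℕ, ∃ h : V → F, (MemLp h 1 volume ∧ MemLp h 2 volume) ∧
      eLpNorm (h - g) 2 volume ≤ ((k : ℝ≥0∞) + 1)⁻¹ := by
    intro k
    obtain ⟨h, hc, hle, hcont, hm⟩ := hg.exists_hasCompactSupport_eLpNorm_sub_le
      (by norm_num) (ε := ((k : ℝ≥0∞) + 1)⁻¹) (by simp)
    exact ⟨h, ⟨memLp_one_iff_integrable.2 (hcont.integrable_of_hasCompactSupport hc), hm⟩, by
      rw [eLpNorm_sub_comm]; exact hle⟩
  choose h h1 h2 using H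
  refine ⟨h, h1, tendsto_of_tendsto_of_tendsto_of_le_of_le tendsto_const_nhds ?_
    (fun _ => zero_le) h2⟩
  have := ENNReal.tendsto_inv_nat_nhds_zero.comp (tendsto_add_atTop_nat 1)
  simpa [Function.comp_def] using this

theorem ae_eq_of_tendsto_eLpNorm_sub {F : Type*} [NormedAddCommGroup F] {u : ℕ → V → F}
    {G G' : V → F} (hu : ∀ k, AEStronglyMeasurable (u k) volume)
    (hG : AEStronglyMeasurable G volume) (hG' : AEStronglyMeasurable G' volume)
    (h : Tendsto (fun k => eLpNorm (u k - G) 2 volume) atTop (𝓝 0))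
    (h' : Tendsto (fun k => eLpNorm (u k - G') 2 volume) atTop (𝓝 0)) : G =ᵐ[volume] G' := by
  have hle : ∀ k, eLpNorm (G - G') 2 volume ≤
      eLpNorm (u k - G) 2 volume + eLpNorm (u k - G') 2 volume := by
    intro k
    have : G - G' = (u k - G') - (u k - G) := by abel
    rw [this, add_comm]
    exact eLpNorm_sub_le ((hu k).sub hG') ((hu k).sub hG) (by norm_num)
  have h0 : eLpNorm (G - G') 2 volume ≤ 0 := by
    have hs := h.add h'
    rw [add_zero] at hs
    exact ge_of_tendsto' hs hle
  have := (eLpNorm_eq_zero_iff (hG.sub hG') (by norm_num)).1 (le_antisymm h0 zero_le)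
  filter_upwards [this] with x hx
  exact sub_eq_zero.1 hx

theorem tendsto_eLpNorm_fourier_sub {h : ℕ → V → ℂ} {g : V → ℂ} (hg : MemLp g 2 volume)
    (hh : ∀ k, MemLp (h k) 1 volume ∧ MemLp (h k) 2 volume)
    (hlim : Tendsto (fun k => eLpNorm (h k - g) 2 volume) atTop (𝓝 0)) :
    Tendsto (fun k => eLpNorm (𝓕 (h k) - fourierL2 g) 2 volume) atTop (𝓝 0) := by
  refine hlim.congr fun k => ?_
  rw [← eLpNorm_fourierL2_sub (hh k).2 hg]
  refine eLpNorm_congr_ae ?_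
  filter_upwards [fourierL2_ae_eq_fourier (memLp_one_iff_integrable.1 (hh k).1) (hh k).2] with x hx
  simp [hx]

/-- An identity `𝓕 ∘ S = T ∘ 𝓕` extends from integrable functions to `L²` when `S` and `T` are
Lipschitz for the `L²` norm. -/
theorem fourierL2_eq_of_lipschitz {S T : (V → ℂ) → V → ℂ} {c d : ℝ≥0∞} (hc : c ≠ ⊤) (hd : d ≠ ⊤)
    (hS1 : ∀ g, MemLp g 1 volume → MemLp (S g) 1 volume)
    (hS2 : ∀ g, MemLp g 2 volume → MemLp (S g) 2 volume)
    (hT : ∀ g, AEStronglyMeasurable g volume → AEStronglyMeasurable (T g) volume)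
    (hSl : ∀ g h, AEStronglyMeasurable g volume → AEStronglyMeasurable h volume →
      eLpNorm (S g - S h) 2 volume ≤ c * eLpNorm (g - h) 2 volume)
    (hTl : ∀ g h, AEStronglyMeasurable g volume → AEStronglyMeasurable h volume →
      eLpNorm (T g - T h) 2 volume ≤ d * eLpNorm (g - h) 2 volume)
    (hST : ∀ g, Integrable g → 𝓕 (S g) = T (𝓕 g)) {g : V → ℂ} (hg : MemLp g 2 volume) :
    fourierL2 (S g) =ᵐ[volume] T (fourierL2 g) := by
  obtain ⟨h, hh, hlim⟩ := exists_seq_tendsto_eLpNorm hg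
  have hcont : ∀ k, Continuous (𝓕 (h k)) := fun k =>
    continuous_fourier_of_integrable (memLp_one_iff_integrable.1 (hh k).1)
  have h0 : ∀ {b : ℝ≥0∞} {u : ℕ → ℝ≥0∞}, b ≠ ⊤ → Tendsto u atTop (𝓝 0) →
      Tendsto (fun k => b * u k) atTop (𝓝 0) := fun hb hu => by
    simpa using ENNReal.Tendsto.const_mul hu (Or.inr hb)
  refine ae_eq_of_tendsto_eLpNorm_sub (u := fun k => 𝓕 (S (h k)))
    (fun k => (continuous_fourier_of_integrable
      (memLp_one_iff_integrable.1 (hS1 _ (hh k).1))).aestronglyMeasurable)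
    (stronglyMeasurable_fourierL2 _).aestronglyMeasurable
    (hT _ (stronglyMeasurable_fourierL2 _).aestronglyMeasurable) ?_ ?_
  · refine tendsto_eLpNorm_fourier_sub (hS2 _ hg) (fun k => ⟨hS1 _ (hh k).1, hS2 _ (hh k).2⟩) ?_
    exact tendsto_of_tendsto_of_tendsto_of_le_of_le tendsto_const_nhds (h0 hc hlim)
      (fun _ => zero_le) (fun k => hSl _ _ (hh k).2.1 hg.1)
  · refine tendsto_of_tendsto_of_tendsto_of_le_of_le tendsto_const_nhds
      (h0 hd (tendsto_eLpNorm_fourier_sub hg hh hlim)) (fun _ => zero_le) (fun k => ?_)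
    simp only [hST _ (memLp_one_iff_integrable.1 (hh k).1)]
    exact hTl _ _ (hcont k).aestronglyMeasurable
      (stronglyMeasurable_fourierL2 _).aestronglyMeasurable

theorem ae_eq_zero_of_fourierL2 {g : V → ℂ} (hg : MemLp g 2 volume)
    (h0 : fourierL2 g =ᵐ[volume] 0) : g =ᵐ[volume] 0 := by
  rw [← eLpNorm_eq_zero_iff hg.1 (p := 2) (by norm_num), ← eLpNorm_fourierL2 hg,
    eLpNorm_congr_ae h0, eLpNorm_zero]

end FourierL2

/-! ### Affine changes of variable and reflection -/

section AffineChange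

variable {V : Type*} [NormedAddCommGroup V] [InnerProductSpace ℝ V] [FiniteDimensional ℝ V]
  [MeasurableSpace V] [BorelSpace V]

omit [FiniteDimensional ℝ V] in
theorem measurableEmbedding_affine (K : V ≃L[ℝ] V) (t : V) :
    MeasurableEmbedding fun x => K (x - t) :=
  ((Homeomorph.subRight t).trans K.toHomeomorph).measurableEmbedding

theorem map_affine_volume (K : V ≃L[ℝ] V) (t : V) :
    Measure.map (fun x => K (x - t)) volume =
      ENNReal.ofReal |K.toLinearEquiv.det⁻¹.1| • (volume : Measure V) := by
  have h1 : (fun x => K (x - t)) = (fun x => (K : V →ₗ[ℝ] V) x) ∘ fun x => x - t := rfl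
  have hdet : LinearMap.det (K : V →ₗ[ℝ] V) ≠ 0 := K.toLinearEquiv.isUnit_det'.ne_zero
  rw [h1, ← Measure.map_map (g := fun x => (K : V →ₗ[ℝ] V) x) (f := fun x => x - t)
    K.continuous.measurable (measurable_id.sub_const t)]
  have h2 : Measure.map (fun x => x - t) (volume : Measure V) = volume :=
    (measurePreserving_sub_right volume t).map_eq
  rw [h2, Measure.map_linearMap_addHaar_eq_smul_addHaar _ hdet]
  congr 3
  simp

theorem eLpNorm_comp_affine {F : Type*} [NormedAddCommGroup F] (K : V ≃L[ℝ] V) (t : V)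
    {p : ℝ≥0∞} (hp : p ≠ ⊤) (g : V → F) :
    eLpNorm (fun x => g (K (x - t))) p volume =
      ENNReal.ofReal |K.toLinearEquiv.det⁻¹.1| ^ (1 / p).toReal * eLpNorm g p volume := by
  have := (measurableEmbedding_affine K t).eLpNorm_map_measure (g := g) (p := p) (μ := volume)
  rw [map_affine_volume, eLpNorm_smul_measure_of_ne_top hp] at this
  rw [← smul_eq_mul, this]; rfl

theorem quasiMeasurePreserving_affine (K : V ≃L[ℝ] V) (t : V) :
    Measure.QuasiMeasurePreserving (fun x => K (x - t)) volume volume :=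
  ⟨(measurableEmbedding_affine K t).measurable, by
    rw [map_affine_volume]; exact Measure.smul_absolutelyContinuous⟩

theorem memLp_comp_affine {F : Type*} [NormedAddCommGroup F] (K : V ≃L[ℝ] V) (t : V)
    {p : ℝ≥0∞} (hp : p ≠ ⊤) {g : V → F} (hg : MemLp g p volume) :
    MemLp (fun x => g (K (x - t))) p volume := by
  refine ⟨hg.1.comp_quasiMeasurePreserving (quasiMeasurePreserving_affine K t), ?_⟩
  rw [eLpNorm_comp_affine K t hp]
  exact ENNReal.mul_lt_top (ENNReal.rpow_lt_top_of_nonneg ENNReal.toReal_nonneg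
    ENNReal.ofReal_ne_top) hg.2

theorem integral_comp_affine (K : V ≃L[ℝ] V) (t : V) (g : V → ℂ) :
    ∫ x, g (K (x - t)) = (|K.toLinearEquiv.det⁻¹.1| : ℝ) * ∫ y, g y := by
  have := (measurableEmbedding_affine K t).integral_map (g := g) (μ := volume)
  rw [map_affine_volume, integral_smul_measure, ENNReal.toReal_ofReal (abs_nonneg _)] at this
  rw [← this]; rfl

theorem fourier_comp_affine (K K' : V ≃L[ℝ] V) (hK : ∀ y ξ, inner ℝ (K.symm y) ξ = inner ℝ y (K' ξ))
    (t : V) (g : V → ℂ) (ξ : V) :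
    𝓕 (fun x => g (K (x - t))) ξ = (|K.toLinearEquiv.det⁻¹.1| : ℝ) *
      (Real.fourierChar (-inner ℝ t ξ) : ℂ) * 𝓕 g (K' ξ) := by
  rw [Real.fourier_eq, Real.fourier_eq]
  have h1 : ∀ x, Real.fourierChar (-inner ℝ x ξ) • g (K (x - t)) =
      (fun y => (Real.fourierChar (-inner ℝ t ξ) : ℂ) *
        (Real.fourierChar (-inner ℝ y (K' ξ)) • g y)) (K (x - t)) := by
    intro x
    simp only [← hK, Circle.smul_def, smul_eq_mul, K.symm_apply_apply, ← mul_assoc]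
    rw [← Circle.coe_mul, ← AddChar.map_add_eq_mul, ← neg_add, ← inner_add_left]
    simp
  simp_rw [h1]
  rw [integral_comp_affine K t (fun y => (Real.fourierChar (-inner ℝ t ξ) : ℂ) *
        (Real.fourierChar (-inner ℝ y (K' ξ)) • g y)), integral_const_mul, mul_assoc]

/-- The `L²` Fourier transform of `x ↦ g (K (x - t))`, where `K'` is the inverse transpose of
`K`. -/
theorem fourierL2_comp_affine (K K' : V ≃L[ℝ] V)
    (hK : ∀ y ξ, inner ℝ (K.symm y) ξ = inner ℝ y (K' ξ)) (t : V) {g : V → ℂ}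
    (hg : MemLp g 2 volume) :
    fourierL2 (fun x => g (K (x - t))) =ᵐ[volume] fun ξ => (|K.toLinearEquiv.det⁻¹.1| : ℝ) *
      (Real.fourierChar (-inner ℝ t ξ) : ℂ) * fourierL2 g (K' ξ) := by
  have hch : Continuous fun ξ : V => (|K.toLinearEquiv.det⁻¹.1| : ℝ) *
      (Real.fourierChar (-inner ℝ t ξ) : ℂ) := by
    have := Real.continuous_fourierChar
    fun_prop
  have hne : ∀ (K : V ≃L[ℝ] V) (q : ℝ≥0∞),
      ENNReal.ofReal |K.toLinearEquiv.det⁻¹.1| ^ (1 / q).toReal ≠ ⊤ := fun K q =>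
    (ENNReal.rpow_lt_top_of_nonneg ENNReal.toReal_nonneg ENNReal.ofReal_ne_top).ne
  refine fourierL2_eq_of_lipschitz (S := fun g x => g (K (x - t)))
    (T := fun G ξ => (|K.toLinearEquiv.det⁻¹.1| : ℝ) *
      (Real.fourierChar (-inner ℝ t ξ) : ℂ) * G (K' ξ)) (hne K 2)
    (ENNReal.mul_ne_top (ENNReal.ofReal_ne_top (r := |K.toLinearEquiv.det⁻¹.1|)) (hne K' 2))
    (fun g hg => memLp_comp_affine K t (by norm_num) hg)
    (fun g hg => memLp_comp_affine K t (by norm_num) hg) ?_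
    (fun g h _ _ => (eLpNorm_comp_affine K t (by norm_num) (g - h)).le) ?_
    (fun g _ => funext fun ξ => fourier_comp_affine K K' hK t g ξ) hg
  · intro G hG
    refine hch.aestronglyMeasurable.mul ?_
    have := hG.comp_quasiMeasurePreserving (quasiMeasurePreserving_affine K' 0)
    simpa [Function.comp_def] using this
  · intro G H _ _
    rw [mul_assoc, ← eLpNorm_comp_affine K' 0 (by norm_num) (G - H)]
    refine eLpNorm_le_mul_eLpNorm_of_ae_le_mul (c := |K.toLinearEquiv.det⁻¹.1|)
      (Eventually.of_forall fun ξ => ?_) 2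
    simp only [Pi.sub_apply, ← mul_sub, norm_mul, Circle.norm_coe, mul_one, sub_zero,
      Complex.norm_real, norm_abs_eq_norm, Real.norm_eq_abs, le_refl]

theorem fourier_star_neg (g : V → ℂ) (ξ : V) :
    𝓕 (fun x => star (g (-x))) ξ = star (𝓕 g ξ) := by
  rw [Real.fourier_eq, Real.fourier_eq]
  have := integral_conj (μ := volume) (f := fun v => Real.fourierChar (-inner ℝ v ξ) • g v)
  change _ = (starRingEnd ℂ) _
  rw [← this, ← integral_neg_eq_self]
  refine integral_congr_ae (Eventually.of_forall fun x => ?_)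
  simp only [neg_neg, inner_neg_left, Circle.smul_def, smul_eq_mul, map_mul]
  congr 1
  rw [← Circle.coe_inv_eq_conj, ← AddChar.map_neg_eq_inv, neg_neg]

theorem memLp_star_neg {F : Type*} [NormedAddCommGroup F] [StarAddMonoid F] [NormedStarGroup F]
    {p : ℝ≥0∞} {g : V → F} (hg : MemLp g p volume) :
    MemLp (fun x => star (g (-x))) p volume :=
  (hg.comp_measurePreserving (Measure.measurePreserving_neg volume)).star

theorem fourierL2_star_neg {g : V → ℂ} (hg : MemLp g 2 volume) :
    fourierL2 (fun x => star (g (-x))) =ᵐ[volume] fun ξ => star (fourierL2 g ξ) := by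
  refine fourierL2_eq_of_lipschitz (S := fun g x => star (g (-x))) (T := fun G ξ => star (G ξ))
    ENNReal.one_ne_top ENNReal.one_ne_top (fun g hg => memLp_star_neg hg)
    (fun g hg => memLp_star_neg hg) (fun G hG => hG.star) ?_ ?_
    (fun g _ => funext fun ξ => fourier_star_neg g ξ) hg
  · intro g h hg hh
    rw [one_mul, ← eLpNorm_comp_measurePreserving (p := 2) (hg.sub hh)
      (Measure.measurePreserving_neg (volume : Measure V))]
    refine eLpNorm_mono (fun x => ?_)
    simp only [Pi.sub_apply, Function.comp_apply, ← star_sub, norm_star, le_refl]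
  · intro g h hg hh
    rw [one_mul]
    refine eLpNorm_mono (fun x => ?_)
    simp only [Pi.sub_apply, ← star_sub, norm_star, le_refl]

end AffineChange

/-! ### Complex coordinates of quaternions -/

section Components

/-- The first complex coordinate of `q = c z₁ + i c z₂`, where `c : ℂ → ℍ` is the embedding
sending the imaginary unit to `j`. -/
def coordOne : ℍ[ℝ] →L[ℝ] ℂ :=
  LinearMap.toContinuousLinearMap
    { toFun := fun q => ⟨q.re, q.imJ⟩
      map_add' := fun _ _ => by apply Complex.ext <;> simp
      map_smul' := fun _ _ => by apply Complex.ext <;> simp }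

/-- The second complex coordinate of `q = c z₁ + i c z₂`, where `c : ℂ → ℍ` is the embedding
sending the imaginary unit to `j`. -/
def coordTwo : ℍ[ℝ] →L[ℝ] ℂ :=
  LinearMap.toContinuousLinearMap
    { toFun := fun q => ⟨q.imI, q.imK⟩
      map_add' := fun _ _ => by apply Complex.ext <;> simp
      map_smul' := fun _ _ => by apply Complex.ext <;> simp }

/-- The quaternion with given complex coordinates. -/
def ofCoords (z₁ z₂ : ℂ) : ℍ[ℝ] := ⟨z₁.re, z₂.re, z₁.im, z₂.im⟩

theorem coordOne_apply (q : ℍ[ℝ]) : coordOne q = ⟨q.re, q.imJ⟩ := rfl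

theorem coordTwo_apply (q : ℍ[ℝ]) : coordTwo q = ⟨q.imI, q.imK⟩ := rfl

theorem coordOne_ofCoords (z₁ z₂ : ℂ) : coordOne (ofCoords z₁ z₂) = z₁ := rfl

theorem coordTwo_ofCoords (z₁ z₂ : ℂ) : coordTwo (ofCoords z₁ z₂) = z₂ := rfl

theorem ofCoords_coord (q : ℍ[ℝ]) : ofCoords (coordOne q) (coordTwo q) = q := rfl

theorem norm_sq_eq_coords (q : ℍ[ℝ]) : ‖q‖ ^ 2 = ‖coordOne q‖ ^ 2 + ‖coordTwo q‖ ^ 2 := by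
  rw [sq, ← Quaternion.normSq_eq_norm_mul_self q, coordOne_apply, coordTwo_apply,
    ← Complex.normSq_eq_norm_sq, ← Complex.normSq_eq_norm_sq, Quaternion.normSq_def']
  simp only [Complex.normSq_mk]
  ring

theorem norm_coordOne_le (q : ℍ[ℝ]) : ‖coordOne q‖ ≤ ‖q‖ := by
  refine abs_le_of_sq_le_sq' ?_ (norm_nonneg q) |>.2
  nlinarith [norm_sq_eq_coords q, sq_nonneg ‖coordTwo q‖]

theorem norm_coordTwo_le (q : ℍ[ℝ]) : ‖coordTwo q‖ ≤ ‖q‖ := by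
  refine abs_le_of_sq_le_sq' ?_ (norm_nonneg q) |>.2
  nlinarith [norm_sq_eq_coords q, sq_nonneg ‖coordOne q‖]

theorem norm_le_coords (q : ℍ[ℝ]) : ‖q‖ ≤ ‖coordOne q‖ + ‖coordTwo q‖ := by
  refine abs_le_of_sq_le_sq' ?_ (by positivity) |>.2
  nlinarith [norm_sq_eq_coords q, norm_nonneg (coordOne q), norm_nonneg (coordTwo q)]

theorem exp_neg_mul_I (θ : ℝ) :
    Complex.exp ((-θ : ℝ) * Complex.I) = ⟨Real.cos θ, -Real.sin θ⟩ := by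
  apply Complex.ext
  · rw [Complex.exp_ofReal_mul_I_re, Real.cos_neg]
  · rw [Complex.exp_ofReal_mul_I_im, Real.sin_neg]

/-- The kernel of the quaternion Fourier transform in complex coordinates. -/
theorem coordOne_kernel (α β : ℝ) (q : ℍ[ℝ]) :
    coordOne (expI (-α) * q * expJ (-β)) =
      (Complex.exp ((-(α + β) : ℝ) * Complex.I) * coordOne q +
        Complex.exp ((-(-α + β) : ℝ) * Complex.I) * coordOne q) / 2 +
      Complex.I / 2 * (Complex.exp ((-(α + β) : ℝ) * Complex.I) * coordTwo q -
        Complex.exp ((-(-α + β) : ℝ) * Complex.I) * coordTwo q) := by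
  simp only [exp_neg_mul_I, coordOne_apply, coordTwo_apply, Quaternion.re_mul, Quaternion.imI_mul,
    Quaternion.imJ_mul, Quaternion.imK_mul]
  simp only [Real.cos_add, Real.sin_add, Real.cos_neg, Real.sin_neg, expI, expJ]
  apply Complex.ext <;> simp <;> ring

theorem coordTwo_kernel (α β : ℝ) (q : ℍ[ℝ]) :
    coordTwo (expI (-α) * q * expJ (-β)) =
      (Complex.exp ((-(α + β) : ℝ) * Complex.I) * coordTwo q +
        Complex.exp ((-(-α + β) : ℝ) * Complex.I) * coordTwo q) / 2 -
      Complex.I / 2 * (Complex.exp ((-(α + β) : ℝ) * Complex.I) * coordOne q -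
        Complex.exp ((-(-α + β) : ℝ) * Complex.I) * coordOne q) := by
  simp only [exp_neg_mul_I, coordOne_apply, coordTwo_apply, Quaternion.re_mul, Quaternion.imI_mul,
    Quaternion.imJ_mul, Quaternion.imK_mul]
  simp only [Real.cos_add, Real.sin_add, Real.cos_neg, Real.sin_neg, expI, expJ]
  apply Complex.ext <;> simp <;> ring

theorem coordOne_mul_star {p q : ℍ[ℝ]} (hq : coordTwo q = 0) :
    coordOne (p * star q) = coordOne p * star (coordOne q) := by
  have h1 : q.imI = 0 := congrArg Complex.re hq
  have h2 : q.imK = 0 := congrArg Complex.im hq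
  simp only [coordOne_apply, Quaternion.re_mul, Quaternion.imJ_mul, Quaternion.re_star,
    Quaternion.imI_star, Quaternion.imJ_star, Quaternion.imK_star, h1, h2]
  apply Complex.ext <;> simp

theorem coordTwo_mul_star {p q : ℍ[ℝ]} (hq : coordTwo q = 0) :
    coordTwo (p * star q) = coordTwo p * star (coordOne q) := by
  have h1 : q.imI = 0 := congrArg Complex.re hq
  have h2 : q.imK = 0 := congrArg Complex.im hq
  simp only [coordOne_apply, coordTwo_apply, Quaternion.imI_mul, Quaternion.imK_mul,
    Quaternion.re_star, Quaternion.imI_star, Quaternion.imJ_star, Quaternion.imK_star, h1, h2]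
  apply Complex.ext <;> simp

theorem coordOne_qj_mul (q : ℍ[ℝ]) : coordOne (qj * q) = Complex.I * coordOne q := by
  simp only [coordOne_apply, Quaternion.re_mul, Quaternion.imJ_mul]
  apply Complex.ext <;> simp [qj]

theorem coordTwo_qj_mul (q : ℍ[ℝ]) : coordTwo (qj * q) = -Complex.I * coordTwo q := by
  simp only [coordTwo_apply, Quaternion.imI_mul, Quaternion.imK_mul]
  apply Complex.ext <;> simp [qj]

theorem coordOne_star (q : ℍ[ℝ]) : coordOne (star q) = star (coordOne q) := by
  simp only [coordOne_apply, Quaternion.re_star, Quaternion.imJ_star]; rfl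

theorem coordTwo_star (q : ℍ[ℝ]) : coordTwo (star q) = -coordTwo q := by
  simp only [coordTwo_apply, Quaternion.imI_star, Quaternion.imK_star]; rfl

/-- A quaternion commuting with `j` lies in the span of `1` and `j`. -/
theorem coordTwo_eq_zero_of_commute_qj {q : ℍ[ℝ]} (h : q * qj = qj * q) : coordTwo q = 0 := by
  have h1 := congrArg (fun r : ℍ[ℝ] => r.imI) h
  have h2 := congrArg (fun r : ℍ[ℝ] => r.imK) h
  simp only [Quaternion.imI_mul, Quaternion.imK_mul] at h1 h2
  simp only [qj] at h1 h2
  rw [coordTwo_apply]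
  apply Complex.ext <;> simp <;> linarith

end Components

/-! ### The two halves of `ℝ^{2n}` -/

section Halves

variable {n : ℕ}

theorem sum_fin_two_mul {M : Type*} [AddCommMonoid M] (f : Fin (2 * n) → M) :
    ∑ k, f k = ∑ k : Fin n, f ⟨k.1, by omega⟩ + ∑ k : Fin n, f ⟨n + k.1, by omega⟩ := by
  rw [← (finCongr (two_mul n).symm).sum_comp, Fin.sum_univ_add]
  rfl

theorem inner_eq_halves (w z : E (2 * n)) :
    inner ℝ w z = inner ℝ (fstHalf w) (fstHalf z) + inner ℝ (sndHalf w) (sndHalf z) := by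
  simp only [PiLp.inner_apply, sum_fin_two_mul]
  rfl

/-- The reflection `(u, v) ↦ (-u, v)` of `ℝ^{2n}`. -/
def reflectFst (n : ℕ) : E (2 * n) ≃ₗᵢ[ℝ] E (2 * n) :=
  LinearIsometryEquiv.piLpCongrRight 2 fun k : Fin (2 * n) =>
    if k.1 < n then LinearIsometryEquiv.neg ℝ else LinearIsometryEquiv.refl ℝ ℝ

theorem fstHalf_reflectFst (w : E (2 * n)) : fstHalf (reflectFst n w) = -fstHalf w := by
  ext k
  simp [fstHalf, reflectFst]

theorem sndHalf_reflectFst (w : E (2 * n)) : sndHalf (reflectFst n w) = sndHalf w := by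
  ext k
  simp [sndHalf, reflectFst]

theorem measurePreserving_reflectFst : MeasurePreserving (reflectFst n) volume volume :=
  (reflectFst n).measurePreserving

theorem ae_coord_ne_zero {m : ℕ} (k : Fin m) : ∀ᵐ w : E m, w k ≠ 0 := by
  let W : Submodule ℝ (E m) :=
    LinearMap.ker (EuclideanSpace.proj (𝕜 := ℝ) k : E m →L[ℝ] ℝ).toLinearMap
  have hW : W ≠ ⊤ := by
    intro h
    have h1 : EuclideanSpace.single k (1 : ℝ) ∈ W := h ▸ Submodule.mem_top
    simp [W] at h1
  have h0 := Measure.addHaar_submodule volume W hW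
  rw [← compl_mem_ae_iff] at h0
  filter_upwards [h0] with w hw h
  exact hw h

theorem ae_sndHalf_ne_zero [NeZero n] : ∀ᵐ w : E (2 * n), sndHalf w ≠ 0 := by
  filter_upwards [ae_coord_ne_zero (⟨n, by have := NeZero.pos n; omega⟩ : Fin (2 * n))] with w hw h
  exact hw (congrArg (fun v : E n => v ⟨0, NeZero.pos n⟩) h)

end Halves

/-! ### The two-sided quaternion Fourier transform on `L²` -/

section QFT

variable {n : ℕ}

/-- First complex coordinate of the quaternion Fourier transform of `c g₁ + i c g₂`, in terms of
the complex Fourier transforms `Φ₁`, `Φ₂` of `g₁`, `g₂`. -/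
def qftOne (Φ₁ Φ₂ : E (2 * n) → ℂ) (w : E (2 * n)) : ℂ :=
  (Φ₁ w + Φ₁ (reflectFst n w)) / 2 + Complex.I / 2 * (Φ₂ w - Φ₂ (reflectFst n w))

/-- Second complex coordinate of the quaternion Fourier transform of `c g₁ + i c g₂`, in terms of
the complex Fourier transforms `Φ₁`, `Φ₂` of `g₁`, `g₂`. -/
def qftTwo (Φ₁ Φ₂ : E (2 * n) → ℂ) (w : E (2 * n)) : ℂ :=
  (Φ₂ w + Φ₂ (reflectFst n w)) / 2 - Complex.I / 2 * (Φ₁ w - Φ₁ (reflectFst n w))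

theorem memLp_coordOne {V : Type*} [MeasurableSpace V] {μ : Measure V} {p : ℝ≥0∞} {g : V → ℍ[ℝ]}
    (hg : MemLp g p μ) : MemLp (fun x => coordOne (g x)) p μ :=
  coordOne.comp_memLp' hg

theorem memLp_coordTwo {V : Type*} [MeasurableSpace V] {μ : Measure V} {p : ℝ≥0∞} {g : V → ℍ[ℝ]}
    (hg : MemLp g p μ) : MemLp (fun x => coordTwo (g x)) p μ :=
  coordTwo.comp_memLp' hg

theorem fourier_eq_halves (g : E (2 * n) → ℂ) (w : E (2 * n)) :
    𝓕 g w = ∫ z, Complex.exp ((-(2 * Real.pi * inner ℝ (fstHalf w) (fstHalf z) +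
      2 * Real.pi * inner ℝ (sndHalf w) (sndHalf z)) : ℝ) * Complex.I) * g z := by
  rw [Real.fourier_eq']
  refine integral_congr_ae (Eventually.of_forall fun z => ?_)
  simp only [smul_eq_mul]
  rw [real_inner_comm, inner_eq_halves, ← mul_add, neg_mul, neg_mul]

theorem fourier_reflectFst_eq_halves (g : E (2 * n) → ℂ) (w : E (2 * n)) :
    𝓕 g (reflectFst n w) = ∫ z, Complex.exp ((-(-(2 * Real.pi * inner ℝ (fstHalf w) (fstHalf z)) +
      2 * Real.pi * inner ℝ (sndHalf w) (sndHalf z)) : ℝ) * Complex.I) * g z := by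
  rw [fourier_eq_halves, fstHalf_reflectFst, sndHalf_reflectFst]
  simp only [inner_neg_left, mul_neg]

theorem continuous_fstHalf : Continuous (fstHalf (n := n)) := by
  unfold fstHalf; fun_prop

theorem continuous_sndHalf : Continuous (sndHalf (n := n)) := by
  unfold sndHalf; fun_prop

theorem integrable_exp_mul {g : E (2 * n) → ℂ} (hg : Integrable g) {θ : E (2 * n) → ℝ}
    (hθ : Continuous θ) : Integrable fun z => Complex.exp ((θ z : ℝ) * Complex.I) * g z := by
  refine hg.bdd_mul (c := 1) (Continuous.aestronglyMeasurable (by fun_prop))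
    (Eventually.of_forall fun z => ?_)
  rw [Complex.norm_exp_ofReal_mul_I]

theorem continuous_ofCoords : Continuous fun z : ℂ × ℂ => ofCoords z.1 z.2 := by
  have : Continuous fun z : ℂ × ℂ => (Quaternion.linearIsometryEquivTuple.symm
    (!₂[z.1.re, z.2.re, z.1.im, z.2.im]) : ℍ[ℝ]) := by fun_prop
  exact this

theorem continuous_expI : Continuous expI := by
  have h : expI = fun θ => ofCoords (Real.cos θ) (Real.sin θ) := by
    funext θ; simp only [expI, ofCoords, Complex.ofReal_re, Complex.ofReal_im]; rfl
  rw [h]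
  exact continuous_ofCoords.comp (f := fun θ : ℝ => ((Real.cos θ : ℂ), (Real.sin θ : ℂ)))
    (by fun_prop)

theorem continuous_expJ : Continuous expJ := by
  have h : expJ = fun θ => ofCoords (Real.cos θ + Real.sin θ * Complex.I) 0 := by
    funext θ
    simp [expJ, ofCoords, -Complex.ofReal_cos, -Complex.ofReal_sin]
    rfl
  rw [h]
  exact continuous_ofCoords.comp
    (f := fun θ : ℝ => ((Real.cos θ + Real.sin θ * Complex.I : ℂ), (0 : ℂ))) (by fun_prop)

theorem norm_expI (θ : ℝ) : ‖expI θ‖ = 1 := by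
  rw [← sq_eq_sq₀ (norm_nonneg _) zero_le_one, sq, ← Quaternion.normSq_eq_norm_mul_self,
    Quaternion.normSq_def']
  simp [expI]

theorem norm_expJ (θ : ℝ) : ‖expJ θ‖ = 1 := by
  rw [← sq_eq_sq₀ (norm_nonneg _) zero_le_one, sq, ← Quaternion.normSq_eq_norm_mul_self,
    Quaternion.normSq_def']
  simp [expJ]

theorem integrable_qftKernel {g : E (2 * n) → ℍ[ℝ]} (hg : Integrable g) (w : E (2 * n)) :
    Integrable fun z => expI (-(2 * Real.pi * inner ℝ (fstHalf w) (fstHalf z))) * g z *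
      expJ (-(2 * Real.pi * inner ℝ (sndHalf w) (sndHalf z))) := by
  have h1 : Continuous fun z : E (2 * n) => (fstHalf w, fstHalf z) :=
    continuous_const.prodMk continuous_fstHalf
  have hf := continuous_fstHalf (n := n)
  have hs := continuous_sndHalf (n := n)
  have hI := continuous_expI
  have hJ := continuous_expJ
  refine hg.mono (((Continuous.aestronglyMeasurable (by fun_prop)).mul hg.1).mul
    (Continuous.aestronglyMeasurable (by fun_prop))) (Eventually.of_forall fun z => ?_)
  rw [norm_mul, norm_mul, norm_expI, norm_expJ, one_mul, mul_one]

theorem integral_half_add_mul_sub {V : Type*} [MeasurableSpace V] {μ : Measure V} {a b c d : V → ℂ}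
    (κ : ℂ) (ha : Integrable a μ) (hb : Integrable b μ) (hc : Integrable c μ)
    (hd : Integrable d μ) :
    ∫ x, ((a x + b x) / 2 + κ * (c x - d x)) ∂μ =
      (∫ x, a x ∂μ + ∫ x, b x ∂μ) / 2 + κ * (∫ x, c x ∂μ - ∫ x, d x ∂μ) := by
  have h1 : Integrable (fun x => (a x + b x) / 2) μ := (ha.add hb).div_const 2
  have h2 : Integrable (fun x => κ * (c x - d x)) μ := (hc.sub hd).const_mul κ
  rw [integral_add h1 h2, integral_div, integral_const_mul, integral_add ha hb, integral_sub hc hd]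

/-- The two-sided transform in complex coordinates. The left kernel `e^{-2πi u·x}` does not commute
with `j`; writing its cosine and sine through `e^{∓2πj u·x}` produces the values at `(-u, v)`. -/
theorem coord_qftIntegral {g : E (2 * n) → ℍ[ℝ]} (hg : Integrable g) (w : E (2 * n)) :
    coordOne (qftIntegral g w) =
        qftOne (𝓕 fun z => coordOne (g z)) (𝓕 fun z => coordTwo (g z)) w ∧
      coordTwo (qftIntegral g w) =
        qftTwo (𝓕 fun z => coordOne (g z)) (𝓕 fun z => coordTwo (g z)) w := by
  have hf := continuous_fstHalf (n := n)
  have hs := continuous_sndHalf (n := n)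
  have h1 : Integrable fun z => coordOne (g z) := coordOne.integrable_comp hg
  have h2 : Integrable fun z => coordTwo (g z) := coordTwo.integrable_comp hg
  have c1 : Continuous fun z : E (2 * n) => -(2 * Real.pi * inner ℝ (fstHalf w) (fstHalf z) +
      2 * Real.pi * inner ℝ (sndHalf w) (sndHalf z)) := by fun_prop
  have c2 : Continuous fun z : E (2 * n) => -(-(2 * Real.pi * inner ℝ (fstHalf w) (fstHalf z)) +
      2 * Real.pi * inner ℝ (sndHalf w) (sndHalf z)) := by fun_prop
  have i11 := integrable_exp_mul h1 c1
  have i12 := integrable_exp_mul h1 c2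
  have i21 := integrable_exp_mul h2 c1
  have i22 := integrable_exp_mul h2 c2
  unfold qftIntegral qftOne qftTwo
  rw [← ContinuousLinearMap.integral_comp_comm _ (integrable_qftKernel hg w),
    ← ContinuousLinearMap.integral_comp_comm _ (integrable_qftKernel hg w)]
  simp only [coordOne_kernel, coordTwo_kernel, fourier_reflectFst_eq_halves]
  simp only [fourier_eq_halves]
  refine ⟨integral_half_add_mul_sub _ i11 i12 i21 i22, ?_⟩
  simp only [sub_eq_add_neg (_ / _), ← neg_mul (Complex.I / 2)]
  exact integral_half_add_mul_sub _ i21 i22 i11 i12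

theorem memLp_comp_reflectFst {p : ℝ≥0∞} {Φ : E (2 * n) → ℂ} (h : MemLp Φ p volume) :
    MemLp (fun w => Φ (reflectFst n w)) p volume :=
  h.comp_measurePreserving measurePreserving_reflectFst

theorem memLp_qftOne {p : ℝ≥0∞} {Φ₁ Φ₂ : E (2 * n) → ℂ} (h1 : MemLp Φ₁ p volume)
    (h2 : MemLp Φ₂ p volume) : MemLp (qftOne Φ₁ Φ₂) p volume := by
  have := ((h1.add (memLp_comp_reflectFst h1)).mul_const (2⁻¹ : ℂ)).add
    ((h2.sub (memLp_comp_reflectFst h2)).const_mul (Complex.I / 2))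
  exact this

theorem memLp_qftTwo {p : ℝ≥0∞} {Φ₁ Φ₂ : E (2 * n) → ℂ} (h1 : MemLp Φ₁ p volume)
    (h2 : MemLp Φ₂ p volume) : MemLp (qftTwo Φ₁ Φ₂) p volume := by
  have := ((h2.add (memLp_comp_reflectFst h2)).mul_const (2⁻¹ : ℂ)).sub
    ((h1.sub (memLp_comp_reflectFst h1)).const_mul (Complex.I / 2))
  exact this

/-- The quaternion Fourier transform on `L²`, assembled from the complex one. -/
def qftL2 (g : E (2 * n) → ℍ[ℝ]) (w : E (2 * n)) : ℍ[ℝ] :=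
  ofCoords (qftOne (fourierL2 fun z => coordOne (g z)) (fourierL2 fun z => coordTwo (g z)) w)
    (qftTwo (fourierL2 fun z => coordOne (g z)) (fourierL2 fun z => coordTwo (g z)) w)

theorem memLp_of_coords {V : Type*} [MeasurableSpace V] {μ : Measure V} {p : ℝ≥0∞} {g : V → ℍ[ℝ]}
    (h1 : MemLp (fun x => coordOne (g x)) p μ) (h2 : MemLp (fun x => coordTwo (g x)) p μ) :
    MemLp g p μ := by
  refine (h1.norm.add h2.norm).mono ?_ (Eventually.of_forall fun x => ?_)
  · exact continuous_ofCoords.comp_aestronglyMeasurable (h1.1.prodMk h2.1)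
  · refine (norm_le_coords _).trans ?_
    exact le_abs_self _

theorem memLp_qftL2 (g : E (2 * n) → ℍ[ℝ]) : MemLp (qftL2 g) 2 volume :=
  memLp_of_coords (memLp_qftOne (memLp_fourierL2 _) (memLp_fourierL2 _))
    (memLp_qftTwo (memLp_fourierL2 _) (memLp_fourierL2 _))

theorem tendsto_eLpNorm_of_coords {V : Type*} [MeasurableSpace V] {μ : Measure V}
    {u : ℕ → V → ℍ[ℝ]}
    (h1 : Tendsto (fun k => eLpNorm (fun x => coordOne (u k x)) 2 μ) atTop (𝓝 0))
    (h2 : Tendsto (fun k => eLpNorm (fun x => coordTwo (u k x)) 2 μ) atTop (𝓝 0))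
    (hm : ∀ k, AEStronglyMeasurable (u k) μ) :
    Tendsto (fun k => eLpNorm (u k) 2 μ) atTop (𝓝 0) := by
  have h := h1.add h2
  rw [add_zero] at h
  refine tendsto_of_tendsto_of_tendsto_of_le_of_le tendsto_const_nhds h (fun _ => zero_le)
    (fun k => ?_)
  have m1 := (coordOne.continuous.comp_aestronglyMeasurable (hm k)).norm
  have m2 := (coordTwo.continuous.comp_aestronglyMeasurable (hm k)).norm
  refine (eLpNorm_mono_real (fun x => norm_le_coords (u k x))).trans
    ((eLpNorm_add_le m1 m2 (by norm_num)).trans_eq ?_)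
  rw [eLpNorm_norm, eLpNorm_norm]

theorem eLpNorm_le_of_norm_le_reflectFst {D₁ D₂ F : E (2 * n) → ℂ}
    (h1 : AEStronglyMeasurable D₁ volume) (h2 : AEStronglyMeasurable D₂ volume)
    (hF : ∀ w, ‖F w‖ ≤ ‖D₁ w‖ + ‖D₁ (reflectFst n w)‖ + (‖D₂ w‖ + ‖D₂ (reflectFst n w)‖)) :
    eLpNorm F 2 volume ≤ eLpNorm D₁ 2 volume + eLpNorm D₁ 2 volume +
      (eLpNorm D₂ 2 volume + eLpNorm D₂ 2 volume) := by
  have key : ∀ {D : E (2 * n) → ℂ}, AEStronglyMeasurable D volume →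
      eLpNorm (fun w => ‖D w‖ + ‖D (reflectFst n w)‖) 2 volume ≤
        eLpNorm D 2 volume + eLpNorm D 2 volume ∧
      AEStronglyMeasurable (fun w => ‖D w‖ + ‖D (reflectFst n w)‖) volume := by
    intro D hD
    have hR := hD.comp_measurePreserving (measurePreserving_reflectFst (n := n))
    refine ⟨(eLpNorm_add_le hD.norm hR.norm (by norm_num)).trans_eq ?_, hD.norm.add hR.norm⟩
    rw [eLpNorm_norm, eLpNorm_norm,
      eLpNorm_comp_measurePreserving hD measurePreserving_reflectFst]
  exact (eLpNorm_mono_real hF).trans ((eLpNorm_add_le (key h1).2 (key h2).2 (by norm_num)).trans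
    (add_le_add (key h1).1 (key h2).1))

theorem tendsto_eLpNorm_of_norm_le_reflectFst {D₁ D₂ F : ℕ → E (2 * n) → ℂ}
    (h1 : ∀ k, AEStronglyMeasurable (D₁ k) volume) (h2 : ∀ k, AEStronglyMeasurable (D₂ k) volume)
    (hF : ∀ k w, ‖F k w‖ ≤
      ‖D₁ k w‖ + ‖D₁ k (reflectFst n w)‖ + (‖D₂ k w‖ + ‖D₂ k (reflectFst n w)‖))
    (t1 : Tendsto (fun k => eLpNorm (D₁ k) 2 volume) atTop (𝓝 0))
    (t2 : Tendsto (fun k => eLpNorm (D₂ k) 2 volume) atTop (𝓝 0)) :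
    Tendsto (fun k => eLpNorm (F k) 2 volume) atTop (𝓝 0) := by
  have h := (t1.add t1).add (t2.add t2)
  simp only [add_zero] at h
  exact tendsto_of_tendsto_of_tendsto_of_le_of_le tendsto_const_nhds h (fun _ => zero_le)
    (fun k => eLpNorm_le_of_norm_le_reflectFst (h1 k) (h2 k) (hF k))

theorem norm_half_add_mul_sub_le (a b c d κ : ℂ) (hκ : ‖κ‖ ≤ 1) :
    ‖(a + b) / 2 + κ * (c - d)‖ ≤ ‖a‖ + ‖b‖ + (‖c‖ + ‖d‖) := by
  refine (norm_add_le _ _).trans (add_le_add ?_ ?_)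
  · rw [norm_div]
    have := norm_add_le a b
    have := norm_nonneg (a + b)
    simp only [RCLike.norm_ofNat]
    linarith
  · rw [norm_mul]
    exact (mul_le_of_le_one_left (norm_nonneg _) hκ).trans (norm_sub_le _ _)

theorem continuous_qftIntegral {g : E (2 * n) → ℍ[ℝ]} (hg : Integrable g) :
    Continuous (qftIntegral g) := by
  have h1 := continuous_fourier_of_integrable (coordOne.integrable_comp hg)
  have h2 := continuous_fourier_of_integrable (coordTwo.integrable_comp hg)
  have hR := (reflectFst n).continuous
  have : qftIntegral g = fun w => ofCoords
      (qftOne (𝓕 fun z => coordOne (g z)) (𝓕 fun z => coordTwo (g z)) w)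
      (qftTwo (𝓕 fun z => coordOne (g z)) (𝓕 fun z => coordTwo (g z)) w) := by
    funext w
    rw [← (coord_qftIntegral hg w).1, ← (coord_qftIntegral hg w).2, ofCoords_coord]
  rw [this]
  refine continuous_ofCoords.comp (Continuous.prodMk ?_ ?_)
  · fun_prop
  · fun_prop

theorem isQFT_qftL2 {g : E (2 * n) → ℍ[ℝ]} (hg : MemLp g 2 volume) : IsQFT g (qftL2 g) := by
  refine ⟨memLp_qftL2 g, fun h hh hlim => ?_⟩
  have hi : ∀ k, Integrable (h k) := fun k => memLp_one_iff_integrable.1 (hh k).1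
  have t1 := tendsto_eLpNorm_fourier_sub (memLp_coordOne hg)
    (h := fun k x => coordOne (h k x))
    (fun k => ⟨memLp_coordOne (hh k).1, memLp_coordOne (hh k).2⟩)
    (tendsto_of_tendsto_of_tendsto_of_le_of_le tendsto_const_nhds hlim (fun _ => zero_le)
      (fun k => eLpNorm_mono (fun x => by
        simp only [Pi.sub_apply, ← map_sub]; exact norm_coordOne_le _)))
  have t2 := tendsto_eLpNorm_fourier_sub (memLp_coordTwo hg)
    (h := fun k x => coordTwo (h k x))
    (fun k => ⟨memLp_coordTwo (hh k).1, memLp_coordTwo (hh k).2⟩)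
    (tendsto_of_tendsto_of_tendsto_of_le_of_le tendsto_const_nhds hlim (fun _ => zero_le)
      (fun k => eLpNorm_mono (fun x => by
        simp only [Pi.sub_apply, ← map_sub]; exact norm_coordTwo_le _)))
  have m1 : ∀ k, AEStronglyMeasurable
      ((𝓕 fun x => coordOne (h k x)) - fourierL2 fun x => coordOne (g x)) volume := fun k =>
    (continuous_fourier_of_integrable (coordOne.integrable_comp (hi k))).aestronglyMeasurable.sub
      (stronglyMeasurable_fourierL2 _).aestronglyMeasurable
  have m2 : ∀ k, AEStronglyMeasurable
      ((𝓕 fun x => coordTwo (h k x)) - fourierL2 fun x => coordTwo (g x)) volume := fun k =>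
    (continuous_fourier_of_integrable (coordTwo.integrable_comp (hi k))).aestronglyMeasurable.sub
      (stronglyMeasurable_fourierL2 _).aestronglyMeasurable
  refine tendsto_eLpNorm_of_coords ?_ ?_
    (fun k => (continuous_qftIntegral (hi k)).aestronglyMeasurable.sub (memLp_qftL2 g).1)
  · refine tendsto_eLpNorm_of_norm_le_reflectFst m1 m2 (fun k w => ?_) t1 t2
    rw [Pi.sub_apply, map_sub, (coord_qftIntegral (hi k) w).1, qftL2, coordOne_ofCoords]
    refine le_of_eq_of_le ?_ (norm_half_add_mul_sub_le _ _ _ _ (Complex.I / 2) (by norm_num))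
    simp only [qftOne, Pi.sub_apply]
    congr 1; ring
  · refine tendsto_eLpNorm_of_norm_le_reflectFst m2 m1 (fun k w => ?_) t2 t1
    rw [Pi.sub_apply, map_sub, (coord_qftIntegral (hi k) w).2, qftL2, coordTwo_ofCoords]
    refine le_of_eq_of_le ?_ (norm_half_add_mul_sub_le _ _ _ _ (-(Complex.I / 2)) (by norm_num))
    simp only [qftTwo, Pi.sub_apply]
    congr 1; ring

theorem qft_ae_eq {g : E (2 * n) → ℍ[ℝ]} (hg : MemLp g 2 volume) : qft g =ᵐ[volume] qftL2 g := by
  have hex : ∃ G, IsQFT g G := ⟨_, isQFT_qftL2 hg⟩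
  have h1 : IsQFT g (qft g) := by
    unfold qft
    rw [dif_pos hex]; exact hex.choose_spec
  obtain ⟨h, hh, hlim⟩ := exists_seq_tendsto_eLpNorm hg
  exact ae_eq_of_tendsto_eLpNorm_sub (u := fun k => qftIntegral (h k))
    (fun k => (continuous_qftIntegral (memLp_one_iff_integrable.1 (hh k).1)).aestronglyMeasurable)
    h1.1.1 (memLp_qftL2 g).1 (h1.2 h hh hlim) ((isQFT_qftL2 hg).2 h hh hlim)

/-- The hypothesis of the convolution theorem forces `ψ` to take its values in the span of `1`
and `j`, and its complex Fourier transform to be even in `u`. Indeed a quaternion commuting with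
`j` has second coordinate `0`, and `F_Q(jψ)(u,v) = j F_Q(ψ)(-u,v)`. -/
theorem fourierL2_of_convolutionHyp [NeZero n] {ψ : E (2 * n) → ℍ[ℝ]} (hψ : MemLp ψ 2 volume)
    (h : ConvolutionHyp ψ) :
    (fun x => coordTwo (ψ x)) =ᵐ[volume] 0 ∧
      ∀ᵐ w, fourierL2 (fun x => coordOne (ψ x)) (reflectFst n w) =
        fourierL2 (fun x => coordOne (ψ x)) w := by
  have hj : MemLp (fun x => qj * ψ x) 2 volume := by
    have hL := (LinearMap.toContinuousLinearMap (LinearMap.mulLeft ℝ qj)).comp_memLp' hψ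
    exact hL
  have e1 : fourierL2 (fun x => coordOne (qj * ψ x)) =ᵐ[volume]
      fun w => Complex.I * fourierL2 (fun x => coordOne (ψ x)) w := by
    simp only [coordOne_qj_mul]
    exact fourierL2_const_mul _ (memLp_coordOne hψ)
  have e2 : fourierL2 (fun x => coordTwo (qj * ψ x)) =ᵐ[volume]
      fun w => -Complex.I * fourierL2 (fun x => coordTwo (ψ x)) w := by
    simp only [coordTwo_qj_mul]
    exact fourierL2_const_mul _ (memLp_coordTwo hψ)
  have hR := (measurePreserving_reflectFst (n := n)).quasiMeasurePreserving
  have key : ∀ᵐ w, fourierL2 (fun x => coordTwo (ψ x)) w = 0 ∧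
      fourierL2 (fun x => coordOne (ψ x)) (reflectFst n w) =
        fourierL2 (fun x => coordOne (ψ x)) w := by
    filter_upwards [h, ae_sndHalf_ne_zero, qft_ae_eq hψ, qft_ae_eq hj, e1, e2, hR.ae e1, hR.ae e2]
      with w hw hw0 hq hqj a1 a2 b1 b2
    have hcomm : qftL2 ψ w * qj = qj * qftL2 ψ w := by
      -- `t` is chosen with `v · t = -1/4`, so that `e^{-2πj v·t} = j`
      have := (hw (-(1 / (4 * ‖sndHalf w‖ ^ 2)) • sndHalf w)).1
      have hn : ‖sndHalf w‖ ≠ 0 := norm_ne_zero_iff.2 hw0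
      have hθ : -(2 * Real.pi * inner ℝ (sndHalf w)
          (-(1 / (4 * ‖sndHalf w‖ ^ 2)) • sndHalf w)) = Real.pi / 2 := by
        rw [inner_smul_right, real_inner_self_eq_norm_sq]
        field_simp
        norm_num
      have hJ : expJ (Real.pi / 2) = qj := by
        simp only [expJ, Real.cos_pi_div_two, Real.sin_pi_div_two]; rfl
      rwa [hθ, hJ, hq] at this
    have hzero : expJ (-(2 * Real.pi * inner ℝ (sndHalf w) 0)) = 1 := by
      rw [inner_zero_right, mul_zero, neg_zero]
      simp only [expJ, Real.cos_zero, Real.sin_zero]; rfl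
    have hjq := (hw 0).2
    rw [hzero, mul_one, mul_one, hqj, hq] at hjq
    have c2 := coordTwo_eq_zero_of_commute_qj hcomm
    have d1 := congrArg coordOne hjq
    have d2 := congrArg coordTwo hjq
    rw [coordOne_qj_mul] at d1
    rw [coordTwo_qj_mul] at d2
    simp only [qftL2, coordOne_ofCoords, coordTwo_ofCoords, qftOne, qftTwo, a1, a2, b1, b2]
      at c2 d1 d2
    set x := fourierL2 (fun x => coordOne (ψ x)) w
    set x' := fourierL2 (fun x => coordOne (ψ x)) (reflectFst n w)
    set y := fourierL2 (fun x => coordTwo (ψ x)) w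
    set y' := fourierL2 (fun x => coordTwo (ψ x)) (reflectFst n w)
    have hI := Complex.I_mul_I
    have f1 : y = y' := by linear_combination d1 + (y - y') * hI
    have f2 : x = x' := by linear_combination d2 + (x - x') * hI
    refine ⟨?_, f2.symm⟩
    rw [← f1, ← f2] at c2
    linear_combination c2
  refine ⟨ae_eq_zero_of_fourierL2 (memLp_coordTwo hψ) ?_, ?_⟩
  · filter_upwards [key] with w hw using hw.1
  · filter_upwards [key] with w hw using hw.2

/-- Under the hypothesis of the convolution theorem, `C_ψ` is the classical admissibility constant
of the complex function `ψ`. -/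
theorem admissibilityConst_eq [NeZero n] {ψ : E (2 * n) → ℍ[ℝ]} (hψ : MemLp ψ 2 volume)
    (h : ConvolutionHyp ψ) :
    admissibilityConst ψ = ∫⁻ l : E (2 * n),
      ENNReal.ofReal (‖fourierL2 (fun x => coordOne (ψ x)) l‖ ^ 2 / |l 0| ^ (2 * n)) := by
  obtain ⟨h2, hev⟩ := fourierL2_of_convolutionHyp hψ h
  have e1 : fourierL2 (fun x => coordOne (star (ψ (-x)))) =ᵐ[volume]
      fun w => star (fourierL2 (fun x => coordOne (ψ x)) w) := by
    have h1 : (fun x => coordOne (star (ψ (-x)))) =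
        fun x => star ((fun y => coordOne (ψ y)) (-x)) := funext fun x => coordOne_star _
    rw [h1]
    exact fourierL2_star_neg (g := fun y => coordOne (ψ y)) (memLp_coordOne hψ)
  have z2 : (fun x => coordTwo (star (ψ (-x)))) =ᵐ[volume] 0 := by
    simp only [coordTwo_star]
    have := (Measure.measurePreserving_neg (volume : Measure (E (2 * n)))).quasiMeasurePreserving.ae
      h2
    filter_upwards [this] with x hx
    simpa using hx
  have e2 : fourierL2 (fun x => coordTwo (star (ψ (-x)))) =ᵐ[volume] 0 := by
    have m := memLp_fourierL2 (fun x => coordTwo (star (ψ (-x))))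
    rw [← eLpNorm_eq_zero_iff m.1 (p := 2) (by norm_num),
      eLpNorm_fourierL2 (memLp_coordTwo (memLp_star_neg hψ)), eLpNorm_congr_ae z2, eLpNorm_zero]
  have hR := (measurePreserving_reflectFst (n := n)).quasiMeasurePreserving
  refine lintegral_congr_ae ?_
  filter_upwards [hev, qft_ae_eq (memLp_star_neg hψ), e1, e2, hR.ae e1, hR.ae e2]
    with w hw hq a1 a2 b1 b2
  have : ‖qft (fun x => star (ψ (-x))) w‖ ^ 2 = ‖fourierL2 (fun x => coordOne (ψ x)) w‖ ^ 2 := by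
    rw [hq, norm_sq_eq_coords, qftL2, coordOne_ofCoords, coordTwo_ofCoords, qftOne, qftTwo, a1, a2,
      b1, b2, hw]
    simp
  rw [this]

end QFT

/-! ### The matrices `S_s A_a` -/

section Matrices

/-- The invertible linear map `x ↦ M x` of `ℝ^m`. -/
def matrixEquiv {m : ℕ} (M : Matrix (Fin m) (Fin m) ℝ) (hM : IsUnit M.det) : E m ≃L[ℝ] E m :=
  LinearEquiv.toContinuousLinearEquiv
    { toFun := fun x => WithLp.toLp 2 (M *ᵥ x.ofLp)
      map_add' := fun x y => by simp [Matrix.mulVec_add]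
      map_smul' := fun c x => by simp [Matrix.mulVec_smul]
      invFun := fun x => WithLp.toLp 2 (M⁻¹ *ᵥ x.ofLp)
      left_inv := fun x => by simp [Matrix.nonsing_inv_mul M hM]
      right_inv := fun x => by simp [Matrix.mul_nonsing_inv M hM] }

theorem matrixEquiv_apply {m : ℕ} (M : Matrix (Fin m) (Fin m) ℝ) (hM : IsUnit M.det) (x : E m) :
    matrixEquiv M hM x = WithLp.toLp 2 (M *ᵥ x.ofLp) := rfl

theorem matrixEquiv_symm_apply {m : ℕ} (M : Matrix (Fin m) (Fin m) ℝ) (hM : IsUnit M.det)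
    (x : E m) : (matrixEquiv M hM).symm x = WithLp.toLp 2 (M⁻¹ *ᵥ x.ofLp) := rfl

theorem det_matrixEquiv_symm {m : ℕ} (M : Matrix (Fin m) (Fin m) ℝ) (hM : IsUnit M.det) :
    ((matrixEquiv M hM).symm.toLinearEquiv.det⁻¹).1 = M.det := by
  have h1 : ((matrixEquiv M hM).symm.toLinearEquiv.det⁻¹).1 =
      LinearMap.det ((matrixEquiv M hM).toLinearEquiv : E m →ₗ[ℝ] E m) := by
    rw [← map_inv, LinearEquiv.coe_det]
    rfl
  have h2 : ((matrixEquiv M hM).toLinearEquiv : E m →ₗ[ℝ] E m) =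
      Matrix.toLin (EuclideanSpace.basisFun (Fin m) ℝ).toBasis
        (EuclideanSpace.basisFun (Fin m) ℝ).toBasis M := by
    rw [← Matrix.toEuclideanLin_eq_toLin_orthonormal]
    rfl
  rw [h1, h2, LinearMap.det_toLin]

theorem inner_matrixEquiv {m : ℕ} (M : Matrix (Fin m) (Fin m) ℝ) (hM : IsUnit M.det)
    (hMt : IsUnit Mᵀ.det) (y ξ : E m) :
    inner ℝ (matrixEquiv M hM y) ξ = inner ℝ y (matrixEquiv Mᵀ hMt ξ) := by
  simp only [EuclideanSpace.inner_eq_star_dotProduct, matrixEquiv_apply, star_trivial]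
  rw [Matrix.dotProduct_mulVec, Matrix.mulVec_transpose]

variable {n : ℕ}

theorem det_shearMatrix (s : E (2 * n - 1)) : (shearMatrix n s).det = 1 := by
  rw [Matrix.det_of_isUpperTriangular]
  · simp [shearMatrix]
  · intro k l hkl
    have h1 : l.1 < k.1 := hkl
    have h2 : k ≠ l := fun h => by subst h; exact lt_irrefl _ h1
    have h3 : ¬ (k.1 = 0 ∧ l.1 ≠ 0) := by omega
    simp [shearMatrix, h2, h3]

theorem abs_sign_mul_rpow {a : ℝ} (ha : a ≠ 0) (r : ℝ) : |Real.sign a * |a| ^ r| = |a| ^ r := by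
  have h1 : |Real.sign a| = 1 := by
    rcases Real.sign_apply_eq_of_ne_zero a ha with h | h <;> simp [h]
  rw [abs_mul, h1, one_mul, abs_of_nonneg (Real.rpow_nonneg (abs_nonneg a) r)]

theorem abs_det_dilationMatrix [NeZero n] {a : ℝ} (ha : a ≠ 0) :
    |(dilationMatrix n a).det| = |a| ^ (2 - 1 / (2 * (n : ℝ))) := by
  have hx : 0 < |a| := abs_pos.2 ha
  have hn : (n : ℝ) ≠ 0 := NeZero.ne _
  rw [dilationMatrix, Matrix.det_diagonal, Fintype.prod_eq_mul_prod_compl 0, abs_mul,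
    if_pos (by simp), Finset.prod_congr rfl (g := fun _ =>
      Real.sign a * |a| ^ (1 / (2 * (n : ℝ)))), Finset.prod_const, Finset.card_compl,
    Finset.card_singleton, Fintype.card_fin, abs_pow, abs_sign_mul_rpow ha, ← Real.rpow_natCast,
    ← Real.rpow_mul hx.le]
  · nth_rewrite 1 [← Real.rpow_one |a|]
    rw [← Real.rpow_add hx]
    congr 1
    rw [Nat.cast_sub (by have := NeZero.pos n; omega)]
    push_cast
    field_simp
    ring
  · intro k hk
    have hk : k ≠ 0 := by simpa using hk
    rw [if_neg fun h => hk (Fin.ext (by simpa using h))]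

/-- `S_s A_a`, the matrix acting on the shearlet. -/
def shearletMatrix (n : ℕ) (a : ℝ) (s : E (2 * n - 1)) : Matrix (Fin (2 * n)) (Fin (2 * n)) ℝ :=
  shearMatrix n s * dilationMatrix n a

theorem shearletMatrix_inv (a : ℝ) (s : E (2 * n - 1)) :
    (dilationMatrix n a)⁻¹ * (shearMatrix n s)⁻¹ = (shearletMatrix n a s)⁻¹ :=
  (Matrix.mul_inv_rev _ _).symm

theorem abs_det_shearletMatrix [NeZero n] {a : ℝ} (ha : a ≠ 0) (s : E (2 * n - 1)) :
    |(shearletMatrix n a s).det| = |a| ^ (2 - 1 / (2 * (n : ℝ))) := by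
  rw [shearletMatrix, Matrix.det_mul, det_shearMatrix, one_mul, abs_det_dilationMatrix ha]

theorem isUnit_det_shearletMatrix [NeZero n] {a : ℝ} (ha : a ≠ 0) (s : E (2 * n - 1)) :
    IsUnit (shearletMatrix n a s).det := by
  rw [isUnit_iff_ne_zero, ← abs_pos, abs_det_shearletMatrix ha]
  exact Real.rpow_pos_of_pos (abs_pos.2 ha) _

theorem isUnit_det_transpose_shearletMatrix [NeZero n] {a : ℝ} (ha : a ≠ 0) (s : E (2 * n - 1)) :
    IsUnit (shearletMatrix n a s)ᵀ.det := by
  rw [Matrix.det_transpose]; exact isUnit_det_shearletMatrix ha s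

theorem transpose_shearletMatrix_mulVec (a : ℝ) (s : E (2 * n - 1)) (ξ : Fin (2 * n) → ℝ)
    (k : Fin (2 * n)) : ((shearletMatrix n a s)ᵀ *ᵥ ξ) k =
      (if k.1 = 0 then a else Real.sign a * |a| ^ (1 / (2 * (n : ℝ)))) *
        ∑ l, shearMatrix n s l k * ξ l := by
  simp only [shearletMatrix, dilationMatrix, Matrix.mulVec, dotProduct, Matrix.transpose_apply,
    Matrix.mul_diagonal, Finset.mul_sum]
  refine Finset.sum_congr rfl fun l _ => ?_
  ring

theorem transpose_shearletMatrix_mulVec_zero [NeZero n] (a : ℝ) (s : E (2 * n - 1))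
    (ξ : Fin (2 * n) → ℝ) : ((shearletMatrix n a s)ᵀ *ᵥ ξ) 0 = a * ξ 0 := by
  rw [transpose_shearletMatrix_mulVec, if_pos (by simp), Finset.sum_eq_single 0]
  · simp [shearMatrix]
  · intro l _ hl
    simp [shearMatrix, hl]
  · simp

theorem transpose_shearletMatrix_mulVec_succ [NeZero n] (a : ℝ) (s : E (2 * n - 1))
    (ξ : Fin (2 * n) → ℝ) (k : Fin (2 * n - 1)) :
    ((shearletMatrix n a s)ᵀ *ᵥ ξ) ⟨k.1 + 1, by omega⟩ =
      Real.sign a * |a| ^ (1 / (2 * (n : ℝ))) * (ξ ⟨k.1 + 1, by omega⟩ + ξ 0 * s k) := by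
  rw [transpose_shearletMatrix_mulVec, if_neg (by simp)]
  congr 1
  have h0 : (0 : Fin (2 * n)) ≠ ⟨k.1 + 1, by omega⟩ := by
    intro h; simpa using congrArg Fin.val h
  rw [← Finset.sum_subset (Finset.subset_univ {⟨k.1 + 1, by omega⟩, (0 : Fin (2 * n))}),
    Finset.sum_pair h0.symm]
  · simp [shearMatrix, h0, mul_comm]
  · intro l _ hl
    simp only [Finset.mem_insert, Finset.mem_singleton, not_or] at hl
    simp [shearMatrix, hl.1, hl.2]

/-- Splitting off the first coordinate of a Euclidean space preserves Lebesgue measure. -/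
theorem exists_splitFirst {N m : ℕ} (h : N = m + 1) :
    ∃ e : E N ≃ᵐ ℝ × E m, MeasurePreserving e volume volume ∧
      (∀ x, (e x).1 = x ⟨0, by omega⟩) ∧ ∀ x (k : Fin m), (e x).2 k = x ⟨k.1 + 1, by omega⟩ := by
  subst h
  refine ⟨((MeasurableEquiv.toLp 2 (Fin (m + 1) → ℝ)).symm.trans
    (MeasurableEquiv.piFinSuccAbove (fun _ => ℝ) 0)).trans
    ((MeasurableEquiv.refl ℝ).prodCongr (MeasurableEquiv.toLp 2 (Fin m → ℝ))), ?_, ?_, ?_⟩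
  · refine ((EuclideanSpace.volume_preserving_symm_measurableEquiv_toLp (Fin (m + 1))).trans
      (volume_preserving_piFinSuccAbove (fun _ => ℝ) 0)).trans ?_
    exact (MeasurePreserving.id volume).prod
      (EuclideanSpace.volume_preserving_symm_measurableEquiv_toLp (Fin m)).symm
  · intro x; rfl
  · intro x k; rfl

end Matrices

/-! ### The Calderón-type identity -/

section Calderon

theorem lintegral_comp_add_smul {m : ℕ} (v : E m) {c : ℝ} (hc : c ≠ 0) {g : E m → ℝ≥0∞}
    (hg : Measurable g) :
    ∫⁻ s, g (v + c • s) = ENNReal.ofReal |(c ^ m)⁻¹| * ∫⁻ y, g y := by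
  have h1 : ∫⁻ s, g (v + c • s) = ∫⁻ y, g (v + y) ∂(Measure.map (fun s : E m => c • s) volume) := by
    rw [lintegral_map (by fun_prop) (by fun_prop)]
  rw [h1, Measure.map_addHaar_smul _ hc, lintegral_smul_measure, lintegral_add_left_eq_self]
  simp

theorem lintegral_comp_mul_right {c : ℝ} (hc : c ≠ 0) {g : ℝ → ℝ≥0∞} (hg : Measurable g) :
    ∫⁻ y, g y = ENNReal.ofReal |c| * ∫⁻ a, g (a * c) := by
  have h1 : ∫⁻ a, g (a * c) = ∫⁻ y, g y ∂(Measure.map (fun a : ℝ => a * c) volume) := by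
    rw [lintegral_map hg (by fun_prop)]
  rw [h1, Real.map_volume_mul_right hc, lintegral_smul_measure, smul_eq_mul, ← mul_assoc,
    ← ENNReal.ofReal_mul (abs_nonneg _), ← abs_mul, mul_inv_cancel₀ hc, abs_one,
    ENNReal.ofReal_one, one_mul]

variable {n : ℕ} [NeZero n]

/-- The density of the left Haar measure, times the square of the normalization
`|a|^{1 - 1/(4n)}` of the Fourier transform of a shearlet. -/
def calderonWeight (n : ℕ) (a : ℝ) : ℝ :=
  1 / |a| ^ (2 * n + 1) * (|a| ^ (1 - 1 / (4 * (n : ℝ)))) ^ 2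

theorem calderonWeight_mul {a c : ℝ} (ha : a ≠ 0) (hc : c ≠ 0) :
    calderonWeight n a * |((Real.sign a * |a| ^ (1 / (2 * (n : ℝ))) * c) ^ (2 * n - 1))⁻¹| =
      |c| * (1 / |a * c| ^ (2 * n)) := by
  have hx : 0 < |a| := abs_pos.2 ha
  have hy : 0 < |c| := abs_pos.2 hc
  have hn : (n : ℝ) ≠ 0 := NeZero.ne _
  rw [abs_inv, abs_pow, abs_mul, abs_sign_mul_rpow ha, calderonWeight, abs_mul]
  have h1 : (|a| ^ (1 - 1 / (4 * (n : ℝ)))) ^ 2 = |a| * |a| ^ (1 - 1 / (2 * (n : ℝ))) := by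
    rw [← Real.rpow_natCast, ← Real.rpow_mul hx.le]
    nth_rewrite 2 [← Real.rpow_one |a|]
    rw [← Real.rpow_add hx]
    congr 1
    push_cast
    field_simp
    ring
  have h2 : (|a| ^ (1 / (2 * (n : ℝ)))) ^ (2 * n - 1) = |a| ^ (1 - 1 / (2 * (n : ℝ))) := by
    rw [← Real.rpow_natCast, ← Real.rpow_mul hx.le]
    congr 1
    rw [Nat.cast_sub (by have := NeZero.pos n; omega)]
    push_cast
    field_simp
  have hz := Real.rpow_pos_of_pos hx (1 - 1 / (2 * (n : ℝ)))
  rw [mul_pow, h1, h2]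
  obtain ⟨m, hm⟩ : ∃ m, 2 * n = m + 1 := ⟨2 * n - 1, by have := NeZero.pos n; omega⟩
  rw [hm, Nat.add_sub_cancel]
  field_simp
  ring

/-- The Calderón-type identity behind the orthogonality relation: for `ξ₁ ≠ 0` the substitution
`ω = A_aᵀ S_sᵀ ξ` turns the weighted measure `da ds` into `dω / |ω₁|^{2n}`. -/
theorem lintegral_transpose_shearletMatrix {G : E (2 * n) → ℝ≥0∞} (hG : Measurable G)
    {ξ : E (2 * n)} (hξ : ξ 0 ≠ 0) :
    ∫⁻ a, ∫⁻ s, ENNReal.ofReal (calderonWeight n a) *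
        G (WithLp.toLp 2 ((shearletMatrix n a s)ᵀ *ᵥ ξ.ofLp)) =
      ∫⁻ ω, ENNReal.ofReal (1 / |ω 0| ^ (2 * n)) * G ω := by
  have hn := NeZero.pos n
  obtain ⟨e, he, he1, he2⟩ := exists_splitFirst (N := 2 * n) (m := 2 * n - 1) (by omega)
  have h0 : (⟨0, by omega⟩ : Fin (2 * n)) = 0 := Fin.ext (by simp)
  rw [h0] at he1
  have hcoord : ∀ a s, WithLp.toLp 2 ((shearletMatrix n a s)ᵀ *ᵥ ξ.ofLp) =
      e.symm (a * ξ 0, (Real.sign a * |a| ^ (1 / (2 * (n : ℝ)))) • (e ξ).2 +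
        (Real.sign a * |a| ^ (1 / (2 * (n : ℝ))) * ξ 0) • s) := by
    intro a s
    rw [MeasurableEquiv.eq_symm_apply]
    refine Prod.ext ?_ ?_
    · rw [he1]; exact transpose_shearletMatrix_mulVec_zero a s ξ.ofLp
    · ext k
      rw [he2]
      refine (transpose_shearletMatrix_mulVec_succ a s ξ.ofLp k).trans ?_
      simp only [PiLp.add_apply, PiLp.smul_apply, smul_eq_mul, he2]
      ring
  have hGe : Measurable fun p => G (e.symm p) := hG.comp e.symm.measurable
  set I : ℝ → ℝ≥0∞ := fun b => ∫⁻ y, G (e.symm (b, y)) with hI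
  have hIm : Measurable I := hGe.lintegral_prod_right'
  have hL : ∀ a : ℝ, a ≠ 0 → ∫⁻ s, ENNReal.ofReal (calderonWeight n a) *
        G (WithLp.toLp 2 ((shearletMatrix n a s)ᵀ *ᵥ ξ.ofLp)) =
      ENNReal.ofReal |ξ 0| * (ENNReal.ofReal (1 / |a * ξ 0| ^ (2 * n)) * I (a * ξ 0)) := by
    intro a ha
    have hα : Real.sign a * |a| ^ (1 / (2 * (n : ℝ))) * ξ 0 ≠ 0 := by
      have : Real.sign a ≠ 0 := by rw [Ne, Real.sign_eq_zero_iff]; exact ha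
      have := (Real.rpow_pos_of_pos (abs_pos.2 ha) (1 / (2 * (n : ℝ)))).ne'
      positivity
    have hg : Measurable fun y => G (e.symm (a * ξ 0, y)) := hGe.comp (by fun_prop)
    simp only [hcoord]
    rw [lintegral_const_mul' _ _ ENNReal.ofReal_ne_top, lintegral_comp_add_smul _ hα hg,
      ← mul_assoc,
      ← ENNReal.ofReal_mul (by unfold calderonWeight; positivity), calderonWeight_mul ha hξ,
      ENNReal.ofReal_mul (abs_nonneg _), mul_assoc]
  have hae : ∀ᵐ a : ℝ, a ≠ 0 := by simp [ae_iff]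
  rw [lintegral_congr_ae (hae.mono hL), lintegral_const_mul _ (by fun_prop),
    ← lintegral_comp_mul_right hξ (g := fun b => ENNReal.ofReal (1 / |b| ^ (2 * n)) * I b)
      (by fun_prop), ← (he.symm e).lintegral_comp_emb e.symm.measurableEmbedding,
    Measure.volume_eq_prod,
    lintegral_prod _ (by
      have : Measurable fun ω : E (2 * n) => ENNReal.ofReal (1 / |ω 0| ^ (2 * n)) * G ω := by
        fun_prop
      exact (this.comp e.symm.measurable).aemeasurable)]
  refine lintegral_congr fun b => ?_
  rw [hI]
  dsimp only
  rw [← lintegral_const_mul' _ _ ENNReal.ofReal_ne_top]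
  refine lintegral_congr fun y => ?_
  rw [← he1, e.apply_symm_apply]

end Calderon

/-! ### Shearlet atoms -/

section Atoms

variable {n : ℕ} {F : Type*} [NormedAddCommGroup F] [NormedSpace ℝ F]

/-- The shearlet atom generated by a function with values in an arbitrary real normed space. -/
def vectorAtom (φ : E (2 * n) → F) (a : ℝ) (s : E (2 * n - 1)) (t x : E (2 * n)) : F :=
  |a| ^ (1 / (4 * (n : ℝ)) - 1) •
    φ (WithLp.toLp 2 (((dilationMatrix n a)⁻¹ * (shearMatrix n s)⁻¹) *ᵥ (x - t).ofLp))

theorem shearletAtom_eq_vectorAtom (ψ : E (2 * n) → ℍ[ℝ]) : shearletAtom ψ = vectorAtom ψ := rfl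

theorem map_vectorAtom {F' : Type*} [NormedAddCommGroup F'] [NormedSpace ℝ F'] (L : F →L[ℝ] F')
    (φ : E (2 * n) → F) (a : ℝ) (s : E (2 * n - 1)) (t x : E (2 * n)) :
    L (vectorAtom φ a s t x) = vectorAtom (fun y => L (φ y)) a s t x :=
  L.map_smul _ _

variable [NeZero n]

theorem vectorAtom_eq {a : ℝ} (ha : a ≠ 0) (φ : E (2 * n) → F) (s : E (2 * n - 1))
    (t : E (2 * n)) : vectorAtom φ a s t = fun x => |a| ^ (1 / (4 * (n : ℝ)) - 1) •
      φ ((matrixEquiv (shearletMatrix n a s) (isUnit_det_shearletMatrix ha s)).symm (x - t)) := by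
  funext x
  rw [vectorAtom, shearletMatrix_inv, matrixEquiv_symm_apply]

theorem vectorAtom_congr {a : ℝ} (ha : a ≠ 0) {φ φ' : E (2 * n) → F} (h : φ =ᵐ[volume] φ')
    (s : E (2 * n - 1)) (t : E (2 * n)) : vectorAtom φ a s t =ᵐ[volume] vectorAtom φ' a s t := by
  rw [vectorAtom_eq ha, vectorAtom_eq ha]
  filter_upwards [(quasiMeasurePreserving_affine (matrixEquiv (shearletMatrix n a s)
    (isUnit_det_shearletMatrix ha s)).symm t).ae h] with x hx
  rw [hx]

/-- The normalization of the atoms preserves the `L²` norm. -/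
theorem eLpNorm_vectorAtom {a : ℝ} (ha : a ≠ 0) (φ : E (2 * n) → F) (s : E (2 * n - 1))
    (t : E (2 * n)) : eLpNorm (vectorAtom φ a s t) 2 volume = eLpNorm φ 2 volume := by
  have hx : 0 < |a| := abs_pos.2 ha
  have hn : (n : ℝ) ≠ 0 := NeZero.ne _
  have h := eLpNorm_const_smul (|a| ^ (1 / (4 * (n : ℝ)) - 1)) (fun x => φ ((matrixEquiv
    (shearletMatrix n a s) (isUnit_det_shearletMatrix ha s)).symm (x - t))) 2 volume
  rw [vectorAtom_eq ha]
  refine h.trans ?_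
  rw [eLpNorm_comp_affine _ t (by norm_num), det_matrixEquiv_symm, abs_det_shearletMatrix ha,
    ← mul_assoc, Real.enorm_eq_ofReal (by positivity),
    ENNReal.ofReal_rpow_of_pos (Real.rpow_pos_of_pos hx _), ← ENNReal.ofReal_mul (by positivity),
    ← Real.rpow_mul hx.le, ← Real.rpow_add hx]
  have : 1 / (4 * (n : ℝ)) - 1 + (2 - 1 / (2 * (n : ℝ))) * (1 / 2 : ℝ≥0∞).toReal = 0 := by
    simp only [one_div, ENNReal.toReal_inv, ENNReal.toReal_ofNat]
    field_simp
    ring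
  rw [this, Real.rpow_zero, ENNReal.ofReal_one, one_mul]

theorem memLp_vectorAtom {a : ℝ} (ha : a ≠ 0) {φ : E (2 * n) → F} (hφ : MemLp φ 2 volume)
    (s : E (2 * n - 1)) (t : E (2 * n)) : MemLp (vectorAtom φ a s t) 2 volume := by
  rw [vectorAtom_eq ha]
  exact (memLp_comp_affine _ t (by norm_num) hφ).const_smul (|a| ^ (1 / (4 * (n : ℝ)) - 1))

/-- The product `σ`-algebra on matrices. -/
instance measurableSpaceMatrix {m : ℕ} : MeasurableSpace (Matrix (Fin m) (Fin m) ℝ) :=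
  MeasurableSpace.pi

instance borelSpaceMatrix {m : ℕ} : BorelSpace (Matrix (Fin m) (Fin m) ℝ) :=
  inferInstanceAs (BorelSpace (Fin m → Fin m → ℝ))

instance secondCountableTopologyMatrix {m : ℕ} :
    SecondCountableTopology (Matrix (Fin m) (Fin m) ℝ) :=
  inferInstanceAs (SecondCountableTopology (Fin m → Fin m → ℝ))

omit [NeZero n] in
theorem measurable_dilationMatrix : Measurable (dilationMatrix n) := by
  refine measurable_pi_iff.2 fun k => measurable_pi_iff.2 fun l => ?_
  simp only [dilationMatrix, Matrix.diagonal_apply]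
  have hs : Measurable Real.sign := by
    unfold Real.sign
    exact Measurable.ite measurableSet_Iio measurable_const
      (Measurable.ite measurableSet_Ioi measurable_const measurable_const)
  split_ifs <;> fun_prop

omit [NeZero n] in
theorem measurable_shearMatrix : Measurable (shearMatrix n) := by
  refine measurable_pi_iff.2 fun k => measurable_pi_iff.2 fun l => ?_
  simp only [shearMatrix, Matrix.of_apply]
  split_ifs <;> fun_prop

theorem measurable_matrix_inv {m : ℕ} :
    Measurable fun A : Matrix (Fin m) (Fin m) ℝ => A⁻¹ := by
  have h1 : Measurable fun A : Matrix (Fin m) (Fin m) ℝ => A.det :=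
    (Continuous.matrix_det continuous_id).measurable
  have h2 : Measurable fun A : Matrix (Fin m) (Fin m) ℝ => A.adjugate :=
    (Continuous.matrix_adjugate continuous_id).measurable
  simp only [Matrix.inv_def, Ring.inverse_eq_inv']
  exact h1.inv.smul h2

theorem measurable_matrix_mul {α : Type*} [MeasurableSpace α] {m : ℕ}
    {A B : α → Matrix (Fin m) (Fin m) ℝ} (hA : Measurable A) (hB : Measurable B) :
    Measurable fun x => A x * B x :=
  (Continuous.matrix_mul continuous_fst continuous_snd).measurable.comp (hA.prodMk hB)

theorem measurable_matrix_mulVec {α : Type*} [MeasurableSpace α] {m : ℕ}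
    {A : α → Matrix (Fin m) (Fin m) ℝ} {v : α → E m} (hA : Measurable A) (hv : Measurable v) :
    Measurable fun x => (WithLp.toLp 2 (A x *ᵥ (v x).ofLp) : E m) := by
  have h : Continuous fun p : Matrix (Fin m) (Fin m) ℝ × E m =>
      (WithLp.toLp 2 (p.1 *ᵥ p.2.ofLp) : E m) := by
    fun_prop
  exact h.measurable.comp (hA.prodMk hv)

omit [NeZero n] in
theorem stronglyMeasurable_vectorAtom {φ : E (2 * n) → F} (hφ : StronglyMeasurable φ) :
    StronglyMeasurable fun q : (ℝ × E (2 * n - 1) × E (2 * n)) × E (2 * n) =>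
      vectorAtom φ q.1.1 q.1.2.1 q.1.2.2 q.2 := by
  have h1 : Measurable fun q : (ℝ × E (2 * n - 1) × E (2 * n)) × E (2 * n) =>
      |q.1.1| ^ (1 / (4 * (n : ℝ)) - 1) := by fun_prop
  refine h1.stronglyMeasurable.smul (hφ.comp_measurable (measurable_matrix_mulVec
    (measurable_matrix_mul (measurable_matrix_inv.comp (measurable_dilationMatrix.comp ?_))
      (measurable_matrix_inv.comp (measurable_shearMatrix.comp ?_))) ?_)) <;> fun_prop

end Atoms

/-! ### The complex shearlet transform -/

section ComplexTransform

variable {n : ℕ}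

/-- The complex shearlet transform. -/
def complexTransform (φ f : E (2 * n) → ℂ) (p : ℝ × E (2 * n - 1) × E (2 * n)) : ℂ :=
  ∫ x, f x * star (vectorAtom φ p.1 p.2.1 p.2.2 x)

/-- The product whose inverse Fourier transform is the shearlet transform as a function of `t`. -/
def transformSymbol (φ f : E (2 * n) → ℂ) (q : ℝ × E (2 * n - 1)) (ξ : E (2 * n)) : ℂ :=
  fourierL2 f ξ * star (((|q.1| ^ (1 - 1 / (4 * (n : ℝ))) : ℝ) : ℂ) *
    fourierL2 φ (WithLp.toLp 2 ((shearletMatrix n q.1 q.2)ᵀ *ᵥ ξ.ofLp)))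

variable [NeZero n]

theorem complexTransform_congr {φ φ' f f' : E (2 * n) → ℂ} (hφ : φ =ᵐ[volume] φ')
    (hf : f =ᵐ[volume] f') {p : ℝ × E (2 * n - 1) × E (2 * n)} (hp : p.1 ≠ 0) :
    complexTransform φ f p = complexTransform φ' f' p := by
  refine integral_congr_ae ?_
  filter_upwards [vectorAtom_congr hp hφ p.2.1 p.2.2, hf] with x h1 h2
  rw [h1, h2]

omit [NeZero n] in
theorem ae_fst_ne_zero : ∀ᵐ p : ℝ × E (2 * n - 1) × E (2 * n), p.1 ≠ 0 := by
  have h : ∀ᵐ a : ℝ, a ≠ 0 := by simp [ae_iff]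
  exact Measure.quasiMeasurePreserving_fst.ae h

theorem aestronglyMeasurable_complexTransform {φ f : E (2 * n) → ℂ} (hφ : MemLp φ 2 volume)
    (hf : MemLp f 2 volume) : AEStronglyMeasurable (complexTransform φ f) volume := by
  refine ⟨complexTransform (hφ.1.mk φ) (hf.1.mk f), ?_, ?_⟩
  · refine StronglyMeasurable.integral_prod_right'
      (f := fun q : (ℝ × E (2 * n - 1) × E (2 * n)) × E (2 * n) => hf.1.mk f q.2 *
        star (vectorAtom (hφ.1.mk φ) q.1.1 q.1.2.1 q.1.2.2 q.2)) ?_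
    exact (hf.1.stronglyMeasurable_mk.comp_measurable measurable_snd).mul
      (stronglyMeasurable_vectorAtom hφ.1.stronglyMeasurable_mk).star
  · filter_upwards [ae_fst_ne_zero] with p hp
    exact complexTransform_congr hφ.1.ae_eq_mk hf.1.ae_eq_mk hp

theorem fourierL2_vectorAtom {a : ℝ} (ha : a ≠ 0) {φ : E (2 * n) → ℂ} (hφ : MemLp φ 2 volume)
    (s : E (2 * n - 1)) (t : E (2 * n)) :
    fourierL2 (vectorAtom φ a s t) =ᵐ[volume] fun ξ => (Real.fourierChar (-inner ℝ t ξ) : ℂ) *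
      (((|a| ^ (1 - 1 / (4 * (n : ℝ))) : ℝ) : ℂ) *
        fourierL2 φ (WithLp.toLp 2 ((shearletMatrix n a s)ᵀ *ᵥ ξ.ofLp))) := by
  have hx : 0 < |a| := abs_pos.2 ha
  have hn : (n : ℝ) ≠ 0 := NeZero.ne _
  set M := shearletMatrix n a s with hM
  have hu := isUnit_det_shearletMatrix ha s
  have hut := isUnit_det_transpose_shearletMatrix ha s
  have e1 := fourierL2_const_mul ((|a| ^ (1 / (4 * (n : ℝ)) - 1) : ℝ) : ℂ)
    (memLp_comp_affine (matrixEquiv M hu).symm t (by norm_num) hφ)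
  have e2 := fourierL2_comp_affine (matrixEquiv M hu).symm (matrixEquiv Mᵀ hut)
    (fun y ξ => inner_matrixEquiv M hu hut y ξ) t hφ
  have e0 : vectorAtom φ a s t = fun x => ((|a| ^ (1 / (4 * (n : ℝ)) - 1) : ℝ) : ℂ) *
      φ ((matrixEquiv M hu).symm (x - t)) := by
    rw [vectorAtom_eq ha]
    funext x
    exact Complex.real_smul
  rw [e0]
  filter_upwards [e1, e2] with ξ h1 h2
  rw [h1, h2, det_matrixEquiv_symm, abs_det_shearletMatrix ha, matrixEquiv_apply]
  have hpow : |a| ^ (1 / (4 * (n : ℝ)) - 1) * |a| ^ (2 - 1 / (2 * (n : ℝ))) =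
      |a| ^ (1 - 1 / (4 * (n : ℝ))) := by
    rw [← Real.rpow_add hx]
    congr 1
    field_simp
    ring
  rw [← hpow, Complex.ofReal_mul]
  ring

theorem complexTransform_eq_fourierInv {φ f : E (2 * n) → ℂ} (hφ : MemLp φ 2 volume)
    (hf : MemLp f 2 volume) {a : ℝ} (ha : a ≠ 0) (s : E (2 * n - 1)) (t : E (2 * n)) :
    complexTransform φ f (a, s, t) = 𝓕⁻ (transformSymbol φ f (a, s)) t := by
  rw [complexTransform, ← integral_fourierL2_mul_conj hf (memLp_vectorAtom ha hφ s t),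
    Real.fourierInv_eq]
  refine integral_congr_ae ?_
  filter_upwards [fourierL2_vectorAtom ha hφ s t] with ξ h
  rw [h, transformSymbol, star_mul', Circle.smul_def, smul_eq_mul, real_inner_comm]
  have : star (Real.fourierChar (-inner ℝ ξ t) : ℂ) = (Real.fourierChar (inner ℝ ξ t) : ℂ) := by
    rw [AddChar.map_neg_eq_inv]
    change (starRingEnd ℂ) _ = _
    rw [← Circle.coe_inv_eq_conj, inv_inv]
  rw [this]
  ring

theorem integrable_transformSymbol {φ f : E (2 * n) → ℂ} {a : ℝ} (ha : a ≠ 0)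
    (s : E (2 * n - 1)) : Integrable (transformSymbol φ f (a, s)) := by
  have h := memLp_comp_affine (matrixEquiv (shearletMatrix n a s)ᵀ
    (isUnit_det_transpose_shearletMatrix ha s)) 0 (p := 2) (by norm_num) (memLp_fourierL2 φ)
  simp only [sub_zero, matrixEquiv_apply] at h
  exact (memLp_fourierL2 f).integrable_mul
    (h.const_mul ((|a| ^ (1 - 1 / (4 * (n : ℝ))) : ℝ) : ℂ)).star

theorem eLpNorm_two_sq {V F : Type*} [MeasurableSpace V] [NormedAddCommGroup F] {μ : Measure V}
    (g : V → F) : eLpNorm g 2 μ ^ 2 = ∫⁻ x, ‖g x‖ₑ ^ 2 ∂μ := by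
  have := eLpNorm_nnreal_pow_eq_lintegral (f := g) (μ := μ) (p := 2) (by norm_num)
  simpa using this

/-- Plancherel's formula for the inverse Fourier integral. -/
theorem lintegral_enorm_fourierInv {V : Type*} [NormedAddCommGroup V] [InnerProductSpace ℝ V]
    [FiniteDimensional ℝ V] [MeasurableSpace V] [BorelSpace V] {h : V → ℂ} (h1 : Integrable h)
    (h2 : MemLp h 2 volume) : ∫⁻ t, ‖𝓕⁻ h t‖ₑ ^ 2 = ∫⁻ ξ, ‖h ξ‖ₑ ^ 2 := by
  rw [← eLpNorm_two_sq h, ← eLpNorm_fourierL2 h2,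
    eLpNorm_congr_ae (fourierL2_ae_eq_fourier h1 h2), eLpNorm_two_sq]
  simp only [Real.fourierInv_eq_fourier_neg]
  exact lintegral_neg_eq_self (fun t => ‖𝓕 h t‖ₑ ^ 2)

omit [NeZero n] in
theorem lintegral_haarLeft {P : ℝ × E (2 * n - 1) × E (2 * n) → ℝ≥0∞}
    (hP : AEMeasurable P volume) : ∫⁻ p, P p ∂haarLeft n =
      ∫⁻ q : ℝ × E (2 * n - 1), ENNReal.ofReal (1 / |q.1| ^ (2 * n + 1)) *
        ∫⁻ t, P (q.1, q.2, t) := by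
  have hd : Measurable fun p : ℝ × E (2 * n - 1) × E (2 * n) =>
      ENNReal.ofReal (1 / |p.1| ^ (2 * n + 1)) := by fun_prop
  -- the hyperplane `a = 0` is null, so the restriction in `haarLeft` changes nothing
  have hae : ∀ᵐ p : ℝ × E (2 * n - 1) × E (2 * n), p ∈ {p | p.1 ≠ 0} := ae_fst_ne_zero
  have hassoc : MeasurePreserving
      (MeasurableEquiv.prodAssoc : (ℝ × E (2 * n - 1)) × E (2 * n) ≃ᵐ _) volume volume :=
    measurePreserving_prodAssoc volume volume volume
  rw [haarLeft, Measure.restrict_eq_self_of_ae_mem hae,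
    lintegral_withDensity_eq_lintegral_mul₀ hd.aemeasurable hP,
    ← hassoc.lintegral_comp_emb MeasurableEquiv.prodAssoc.measurableEmbedding,
    Measure.volume_eq_prod, lintegral_prod]
  · refine lintegral_congr fun q => ?_
    rw [← lintegral_const_mul' _ _ ENNReal.ofReal_ne_top]
    rfl
  · exact (hd.aemeasurable.mul hP).comp_quasiMeasurePreserving hassoc.quasiMeasurePreserving

/-- The orthogonality relation for the complex shearlet transform. -/
theorem lintegral_enorm_complexTransform {φ f : E (2 * n) → ℂ} (hφ : MemLp φ 2 volume)
    (hf : MemLp f 2 volume)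
    (hC : ∫⁻ ω, ENNReal.ofReal (1 / |ω 0| ^ (2 * n)) * ‖fourierL2 φ ω‖ₑ ^ 2 < ⊤) :
    ∫⁻ p, ‖complexTransform φ f p‖ₑ ^ 2 ∂haarLeft n =
      (∫⁻ ω, ENNReal.ofReal (1 / |ω 0| ^ (2 * n)) * ‖fourierL2 φ ω‖ₑ ^ 2) *
        ∫⁻ x, ‖f x‖ₑ ^ 2 := by
  set C := ∫⁻ ω, ENNReal.ofReal (1 / |ω 0| ^ (2 * n)) * ‖fourierL2 φ ω‖ₑ ^ 2
  have hmf : Measurable (fourierL2 f) := (stronglyMeasurable_fourierL2 f).measurable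
  have hmφ : Measurable (fourierL2 φ) := (stronglyMeasurable_fourierL2 φ).measurable
  have hM : Measurable fun r : (ℝ × E (2 * n - 1)) × E (2 * n) =>
      (WithLp.toLp 2 ((shearletMatrix n r.1.1 r.1.2)ᵀ *ᵥ r.2.ofLp) : E (2 * n)) := by
    refine measurable_matrix_mulVec ?_ measurable_snd
    have hT : Measurable fun A : Matrix (Fin (2 * n)) (Fin (2 * n)) ℝ => Aᵀ :=
      (Continuous.matrix_transpose continuous_id).measurable
    exact hT.comp (measurable_matrix_mul (measurable_shearMatrix.comp (by fun_prop))
      (measurable_dilationMatrix.comp (by fun_prop)))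
  have hw : Measurable (calderonWeight n) := by unfold calderonWeight; fun_prop
  have hD : Measurable fun r : (ℝ × E (2 * n - 1)) × E (2 * n) =>
      ‖fourierL2 f r.2‖ₑ ^ 2 * (ENNReal.ofReal (calderonWeight n r.1.1) *
        ‖fourierL2 φ (WithLp.toLp 2 ((shearletMatrix n r.1.1 r.1.2)ᵀ *ᵥ r.2.ofLp))‖ₑ ^ 2) :=
    ((hmf.comp measurable_snd).enorm.pow_const 2).mul
      ((hw.comp (by fun_prop)).ennreal_ofReal.mul ((hmφ.comp hM).enorm.pow_const 2))
  have hsymb : ∀ (q : ℝ × E (2 * n - 1)) ξ,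
      ENNReal.ofReal (1 / |q.1| ^ (2 * n + 1)) * ‖transformSymbol φ f q ξ‖ₑ ^ 2 =
      ‖fourierL2 f ξ‖ₑ ^ 2 * (ENNReal.ofReal (calderonWeight n q.1) *
        ‖fourierL2 φ (WithLp.toLp 2 ((shearletMatrix n q.1 q.2)ᵀ *ᵥ ξ.ofLp))‖ₑ ^ 2) := by
    intro q ξ
    have h0 : 0 ≤ |q.1| ^ (1 - 1 / (4 * (n : ℝ))) := Real.rpow_nonneg (abs_nonneg _) _
    have h1 : ‖((|q.1| ^ (1 - 1 / (4 * (n : ℝ))) : ℝ) : ℂ)‖ₑ =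
        ENNReal.ofReal (|q.1| ^ (1 - 1 / (4 * (n : ℝ)))) := by
      rw [← ofReal_norm, Complex.norm_real, Real.norm_of_nonneg h0]
    have h2 : ∀ z : ℂ, ‖star z‖ₑ = ‖z‖ₑ := fun z => by rw [← ofReal_norm, norm_star, ofReal_norm]
    rw [transformSymbol, enorm_mul, h2, enorm_mul, h1, calderonWeight,
      ENNReal.ofReal_mul (by positivity), ENNReal.ofReal_pow h0]
    ring
  have hT1 : ∫⁻ q : ℝ × E (2 * n - 1), ENNReal.ofReal (1 / |q.1| ^ (2 * n + 1)) *
      ∫⁻ ξ, ‖transformSymbol φ f q ξ‖ₑ ^ 2 = C * ∫⁻ x, ‖f x‖ₑ ^ 2 := by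
    simp only [← lintegral_const_mul' _ _ ENNReal.ofReal_ne_top, hsymb]
    rw [lintegral_lintegral_swap hD.aemeasurable]
    have : ∀ᵐ ξ : E (2 * n), ∫⁻ q : ℝ × E (2 * n - 1), ‖fourierL2 f ξ‖ₑ ^ 2 *
        (ENNReal.ofReal (calderonWeight n q.1) *
        ‖fourierL2 φ (WithLp.toLp 2 ((shearletMatrix n q.1 q.2)ᵀ *ᵥ ξ.ofLp))‖ₑ ^ 2) =
        C * ‖fourierL2 f ξ‖ₑ ^ 2 := by
      filter_upwards [ae_coord_ne_zero (0 : Fin (2 * n))] with ξ hξ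
      rw [lintegral_const_mul' _ _ (by simp), Measure.volume_eq_prod, lintegral_prod,
        lintegral_transpose_shearletMatrix (G := fun y => ‖fourierL2 φ y‖ₑ ^ 2)
          (hmφ.enorm.pow_const 2) hξ, mul_comm]
      exact ((hw.comp measurable_fst).ennreal_ofReal.mul
        ((hmφ.comp (hM.comp measurable_prodMk_right)).enorm.pow_const 2)).aemeasurable
    rw [lintegral_congr_ae this, lintegral_const_mul' _ _ hC.ne, ← eLpNorm_two_sq,
      eLpNorm_fourierL2 hf, eLpNorm_two_sq]
  have hfin : C * ∫⁻ x, ‖f x‖ₑ ^ 2 < ⊤ := by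
    rw [← eLpNorm_two_sq]
    exact ENNReal.mul_lt_top hC (ENNReal.pow_lt_top hf.2)
  rw [lintegral_haarLeft ((aestronglyMeasurable_complexTransform hφ hf).enorm.pow_const 2), ← hT1]
  have hmeas : Measurable fun q : ℝ × E (2 * n - 1) =>
      ENNReal.ofReal (1 / |q.1| ^ (2 * n + 1)) * ∫⁻ ξ, ‖transformSymbol φ f q ξ‖ₑ ^ 2 := by
    simp only [← lintegral_const_mul' _ _ ENNReal.ofReal_ne_top, hsymb]
    exact hD.lintegral_prod_right'
  have hne : ∀ᵐ q : ℝ × E (2 * n - 1), q.1 ≠ 0 := by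
    have h : ∀ᵐ a : ℝ, a ≠ 0 := by simp [ae_iff]
    exact Measure.quasiMeasurePreserving_fst.ae h
  -- for almost every `(a, s)` the symbol is square integrable, and Plancherel's formula applies
  refine lintegral_congr_ae ?_
  filter_upwards [ae_lt_top hmeas (hT1.trans_lt hfin).ne, hne] with q hq hq0
  have hw0 : ENNReal.ofReal (1 / |q.1| ^ (2 * n + 1)) ≠ 0 := by
    rw [Ne, ENNReal.ofReal_eq_zero, not_le]
    have := abs_pos.2 hq0
    positivity
  have hlt : ∫⁻ ξ, ‖transformSymbol φ f q ξ‖ₑ ^ 2 < ⊤ := by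
    by_contra hcon
    rw [not_lt_top_iff.1 hcon, ENNReal.mul_top hw0] at hq
    exact lt_irrefl _ hq
  have hint : Integrable (transformSymbol φ f q) := integrable_transformSymbol hq0 q.2
  have hL2 : MemLp (transformSymbol φ f q) 2 volume := by
    refine ⟨hint.1, ?_⟩
    rw [← eLpNorm_two_sq] at hlt
    exact (ENNReal.pow_lt_top_iff.1 hlt).resolve_right (by norm_num)
  congr 1
  rw [← lintegral_enorm_fourierInv hint hL2]
  exact lintegral_congr fun t => by
    rw [complexTransform_eq_fourierInv hφ hf hq0]

end ComplexTransform

/-! ### Entropy of a bounded integrable function -/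

section Entropy

/-- If `0 ≤ P ≤ K` almost everywhere, then `-P ln P ≥ P ln (1/K)`, and integrating gives the lower
bound for the entropy. -/
theorem le_entropy {α : Type*} [MeasurableSpace α] {μ : Measure α} {P : α → ℝ} {K : ℝ}
    (hP : Integrable P μ) (hP0 : ∀ x, 0 ≤ P x) (hPK : ∀ᵐ x ∂μ, P x ≤ K) :
    (((∫ x, P x ∂μ) * Real.log (1 / K) : ℝ) : EReal) ≤ entropy μ P := by
  have hpt : ∀ᵐ x ∂μ, P x * Real.log (1 / K) ≤ -(Real.log (P x) * P x) := by
    filter_upwards [hPK] with x hx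
    rcases (hP0 x).eq_or_lt with h | h
    · simp [← h]
    · rw [one_div, Real.log_inv]
      nlinarith [Real.log_le_log h hx]
  have hm : AEMeasurable (fun x => Real.log (P x) * P x) μ :=
    (Real.measurable_log.comp_aemeasurable hP.1.aemeasurable).mul hP.1.aemeasurable
  have hbint : Integrable (fun x => P x * Real.log (1 / K)) μ := hP.mul_const _
  -- the negative part of `-P ln P` has finite integral
  have hneg : ∫⁻ x, ENNReal.ofReal (Real.log (P x) * P x) ∂μ < ⊤ := by
    refine lt_of_le_of_lt (lintegral_mono_ae ?_) (hbint.neg.lintegral_lt_top)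
    filter_upwards [hpt] with x hx
    exact ENNReal.ofReal_le_ofReal (by simp only [Pi.neg_apply]; linarith)
  unfold entropy
  by_cases hpos : ∫⁻ x, ENNReal.ofReal (-(Real.log (P x) * P x)) ∂μ = ⊤
  · rw [hpos, EReal.coe_ennreal_top, EReal.top_sub]
    · exact le_top
    · rw [Ne, EReal.coe_ennreal_eq_top_iff]
      exact hneg.ne
  · have hint : Integrable (fun x => -(Real.log (P x) * P x)) μ := by
      refine ⟨hm.neg.aestronglyMeasurable, ?_⟩
      rw [hasFiniteIntegral_iff_enorm]
      have : ∀ x, ‖-(Real.log (P x) * P x)‖ₑ ≤ ENNReal.ofReal (-(Real.log (P x) * P x)) +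
          ENNReal.ofReal (Real.log (P x) * P x) := by
        intro x
        rw [Real.enorm_eq_ofReal_abs, abs_neg]
        rcases abs_cases (Real.log (P x) * P x) with h | h <;> rw [h.1]
        · exact le_add_self
        · exact le_self_add
      refine lt_of_le_of_lt (lintegral_mono this) ?_
      rw [lintegral_add_right' _ hm.ennreal_ofReal]
      exact ENNReal.add_lt_top.2 ⟨lt_top_iff_ne_top.2 hpos, hneg⟩
    have h1 := integral_eq_lintegral_pos_part_sub_lintegral_neg_part hint
    simp only [neg_neg] at h1
    have h2 : (∫ x, P x ∂μ) * Real.log (1 / K) ≤ ∫ x, -(Real.log (P x) * P x) ∂μ := by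
      rw [← integral_mul_const]
      exact integral_mono_ae hbint hint hpt
    rw [h1] at h2
    refine (EReal.coe_le_coe_iff.2 h2).trans_eq ?_
    rw [EReal.coe_sub, EReal.coe_ennreal_toReal hpos, EReal.coe_ennreal_toReal hneg.ne]

end Entropy

/-! ### The quaternion shearlet transform -/

section QuaternionTransform

variable {n : ℕ} [NeZero n]

theorem norm_shearletTransform_le {ψ f : E (2 * n) → ℍ[ℝ]} (hψ : MemLp ψ 2 volume)
    (hf : MemLp f 2 volume) {p : ℝ × E (2 * n - 1) × E (2 * n)} (hp : p.1 ≠ 0) :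
    ‖shearletTransform ψ f p‖ ≤ l2norm f * l2norm ψ := by
  have hA : MemLp (shearletAtom ψ p.1 p.2.1 p.2.2) 2 volume := memLp_vectorAtom hp hψ _ _
  have h := eLpNorm_smul_le_mul_eLpNorm (p := 2) (q := 2) (r := 1) hA.star.1 hf.1
  have hle : ENNReal.ofReal ‖shearletTransform ψ f p‖ ≤
      eLpNorm f 2 volume * eLpNorm ψ 2 volume := by
    rw [ofReal_norm, ← eLpNorm_vectorAtom hp ψ p.2.1 p.2.2]
    refine (enorm_integral_le_lintegral_enorm _).trans ?_
    rw [eLpNorm_one_eq_lintegral_enorm, eLpNorm_star] at h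
    exact h
  rw [l2norm, l2norm, ← ENNReal.toReal_mul]
  exact (ENNReal.ofReal_le_iff_le_toReal (ENNReal.mul_ne_top hf.2.ne hψ.2.ne)).1 hle

/-- For `ψ` with values in the span of `1` and `j`, the quaternion shearlet transform consists of
the complex shearlet transforms of the two coordinates of `f`. -/
theorem norm_sq_shearletTransform {ψ f : E (2 * n) → ℍ[ℝ]} (hψ : MemLp ψ 2 volume)
    (h2 : (fun x => coordTwo (ψ x)) =ᵐ[volume] 0)
    (hf : MemLp f 2 volume) {p : ℝ × E (2 * n - 1) × E (2 * n)} (hp : p.1 ≠ 0) :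
    ‖shearletTransform ψ f p‖ ^ 2 =
      ‖complexTransform (fun x => coordOne (ψ x)) (fun x => coordOne (f x)) p‖ ^ 2 +
      ‖complexTransform (fun x => coordOne (ψ x)) (fun x => coordTwo (f x)) p‖ ^ 2 := by
  have hA : MemLp (shearletAtom ψ p.1 p.2.1 p.2.2) 2 volume := memLp_vectorAtom hp hψ _ _
  have hint : Integrable (fun x => f x * star (shearletAtom ψ p.1 p.2.1 p.2.2 x)) volume :=
    hf.integrable_mul hA.star
  have hA2 : ∀ᵐ x, coordTwo (shearletAtom ψ p.1 p.2.1 p.2.2 x) = 0 := by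
    filter_upwards [vectorAtom_congr hp h2 p.2.1 p.2.2] with x hx
    rw [shearletAtom_eq_vectorAtom, map_vectorAtom, hx]
    exact smul_zero _
  have hA1 : ∀ x, coordOne (shearletAtom ψ p.1 p.2.1 p.2.2 x) =
      vectorAtom (fun y => coordOne (ψ y)) p.1 p.2.1 p.2.2 x := fun x => map_vectorAtom _ _ _ _ _ _
  rw [norm_sq_eq_coords, shearletTransform, ← ContinuousLinearMap.integral_comp_comm _ hint,
    ← ContinuousLinearMap.integral_comp_comm _ hint]
  congr 3
  · refine integral_congr_ae ?_
    filter_upwards [hA2] with x hx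
    rw [coordOne_mul_star hx, hA1]
  · refine integral_congr_ae ?_
    filter_upwards [hA2] with x hx
    rw [coordTwo_mul_star hx, hA1]

omit [NeZero n] in
theorem haarLeft_absolutelyContinuous : haarLeft n ≪ volume :=
  (withDensity_absolutelyContinuous _ _).trans Measure.restrict_le_self.absolutelyContinuous

theorem ofReal_norm_sq {F : Type*} [NormedAddCommGroup F] (z : F) :
    ENNReal.ofReal (‖z‖ ^ 2) = ‖z‖ₑ ^ 2 := by
  rw [ENNReal.ofReal_pow (norm_nonneg _), ofReal_norm]

/-- The orthogonality relation: `|SH_ψ f|²` has integral `C_ψ ‖f‖²`. -/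
theorem shearletTransform_integral {ψ f : E (2 * n) → ℍ[ℝ]} (hψ : IsAdmissible ψ)
    (hconv : ConvolutionHyp ψ) (hf : MemLp f 2 volume) :
    Integrable (fun p => ‖shearletTransform ψ f p‖ ^ 2) (haarLeft n) ∧
      ∫ p, ‖shearletTransform ψ f p‖ ^ 2 ∂haarLeft n =
        (admissibilityConst ψ).toReal * l2norm f ^ 2 := by
  obtain ⟨h2, -⟩ := fourierL2_of_convolutionHyp hψ.1 hconv
  have hφ := memLp_coordOne hψ.1
  have hf1 := memLp_coordOne hf
  have hf2 := memLp_coordTwo hf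
  have hC : ∫⁻ ω : E (2 * n), ENNReal.ofReal (1 / |ω 0| ^ (2 * n)) *
      ‖fourierL2 (fun x => coordOne (ψ x)) ω‖ₑ ^ 2 = admissibilityConst ψ := by
    rw [admissibilityConst_eq hψ.1 hconv]
    refine lintegral_congr fun ω => ?_
    rw [← ofReal_norm_sq, ← ENNReal.ofReal_mul (by positivity)]
    congr 1
    ring
  have hfin := hψ.2
  have o1 := lintegral_enorm_complexTransform hφ hf1 (hC.trans_lt hfin)
  have o2 := lintegral_enorm_complexTransform hφ hf2 (hC.trans_lt hfin)
  have m1 := aestronglyMeasurable_complexTransform hφ hf1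
  have m2 := aestronglyMeasurable_complexTransform hφ hf2
  have hae : ∀ᵐ p ∂haarLeft n, p.1 ≠ 0 := haarLeft_absolutelyContinuous.ae_le ae_fst_ne_zero
  have heq : (fun p => ‖shearletTransform ψ f p‖ ^ 2) =ᵐ[haarLeft n] fun p =>
      ‖complexTransform (fun x => coordOne (ψ x)) (fun x => coordOne (f x)) p‖ ^ 2 +
      ‖complexTransform (fun x => coordOne (ψ x)) (fun x => coordTwo (f x)) p‖ ^ 2 := by
    filter_upwards [hae] with p hp
    exact norm_sq_shearletTransform hψ.1 h2 hf hp
  have hm : AEStronglyMeasurable (fun p => ‖shearletTransform ψ f p‖ ^ 2) (haarLeft n) := by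
    refine AEStronglyMeasurable.congr ?_ heq.symm
    exact ((m1.norm.pow 2).add (m2.norm.pow 2)).mono_ac haarLeft_absolutelyContinuous
  have hl : ∫⁻ p, ENNReal.ofReal (‖shearletTransform ψ f p‖ ^ 2) ∂haarLeft n =
      admissibilityConst ψ * eLpNorm f 2 volume ^ 2 := by
    rw [lintegral_congr_ae (g := fun p =>
      ‖complexTransform (fun x => coordOne (ψ x)) (fun x => coordOne (f x)) p‖ₑ ^ 2 +
      ‖complexTransform (fun x => coordOne (ψ x)) (fun x => coordTwo (f x)) p‖ₑ ^ 2),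
      lintegral_add_left' ((m1.mono_ac haarLeft_absolutelyContinuous).enorm.pow_const 2), o1, o2,
      hC, ← mul_add, ← lintegral_add_left' (hf1.1.enorm.pow_const 2), eLpNorm_two_sq]
    · congr 1
      refine lintegral_congr fun x => ?_
      rw [← ofReal_norm_sq, ← ofReal_norm_sq, ← ofReal_norm_sq,
        ← ENNReal.ofReal_add (by positivity) (by positivity), norm_sq_eq_coords (f x)]
    · filter_upwards [heq] with p hp
      rw [hp, ENNReal.ofReal_add (by positivity) (by positivity), ofReal_norm_sq, ofReal_norm_sq]
  have hnn : ∀ p, 0 ≤ ‖shearletTransform ψ f p‖ ^ 2 := fun p => by positivity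
  refine ⟨⟨hm, ?_⟩, ?_⟩
  · rw [hasFiniteIntegral_iff_ofReal (Eventually.of_forall hnn), hl]
    exact ENNReal.mul_lt_top hfin (ENNReal.pow_lt_top hf.2)
  · rw [integral_eq_lintegral_of_nonneg_ae (Eventually.of_forall hnn) hm, hl, ENNReal.toReal_mul,
      ENNReal.toReal_pow, l2norm]

end QuaternionTransform

end QuaternionShearlet

end

theorem mainTheorem7 (n : ℕ) [NeZero n]
    (ψ f : QuaternionShearlet.E (2 * n) → ℍ[ℝ])
    (hψ : QuaternionShearlet.IsAdmissible ψ) (hψ0 : ¬ ψ =ᵐ[volume] 0)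
    (hconv : QuaternionShearlet.ConvolutionHyp ψ)
    (hf : MemLp f 2 volume) (hf0 : ¬ f =ᵐ[volume] 0) :
    (((QuaternionShearlet.admissibilityConst ψ).toReal * QuaternionShearlet.l2norm f ^ 2 *
        Real.log (1 / (QuaternionShearlet.l2norm f ^ 2 * QuaternionShearlet.l2norm ψ ^ 2)) : ℝ) :
        EReal) ≤
      QuaternionShearlet.entropy (QuaternionShearlet.haarLeft n)
        (fun p => ‖QuaternionShearlet.shearletTransform ψ f p‖ ^ 2) := by
  obtain ⟨hint, hval⟩ := QuaternionShearlet.shearletTransform_integral hψ hconv hf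
  rw [← hval, ← mul_pow]
  refine QuaternionShearlet.le_entropy hint (fun p => by positivity) ?_
  filter_upwards [QuaternionShearlet.haarLeft_absolutelyContinuous.ae_le
    QuaternionShearlet.ae_fst_ne_zero] with p hp
  exact pow_le_pow_left₀ (norm_nonneg _)
    (QuaternionShearlet.norm_shearletTransform_le hψ.1 hf hp) 2
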